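/- Let $f$ be a transcendental meromorphic function in the complex plane $\mathbb{C}$ (i.e. meromorphic in $\mathbb{C}$ and not rational), with Nevanlinna characteristic $T(r,f)$. A meromorphic function $b\not\equiv 0,\infty$ in $\mathbb{C}$ is called a small function of $f$ if there is a set $E\subset(0,\infty)$ of finite Lebesgue measure such that $T(r,b)=o(T(r,f))$ as $r\to\infty$, $r\notin E$. Let $k\ge 1$ be an integer, let $q_0\ge 3$, $q_1,\ldots,q_{k-1}\ge 0$ and $q_k\ge 1$ be integers, let $a$ and $\varphi$ be small functions of $f$ (so $a,\varphi\not\equiv 0,\infty$), and put $$M[f]=a\,(f)^{q_0}(f')^{q_1}\cdots(f^{(k)})^{q_k}.$$ Then $M[f]-\varphi$ does not vanish identically and has infinitely many (distinct) zeros in $\mathbb{C}$. -/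

import Mathlib

open Filter MeasureTheory

/-- `f` agrees, away from a discrete closed set, with a rational function. (Values of a meromorphic
function at isolated points, in particular at its poles, carry no information.) -/
def IsRationalFunction (f : ℂ → ℂ) : Prop :=
  ∃ p q : Polynomial ℂ, q ≠ 0 ∧ f =ᶠ[codiscrete ℂ] fun z => p.eval z / q.eval z

/-- A transcendental meromorphic function in the complex plane: meromorphic on `ℂ`, not rational. -/
def IsTranscendentalMeromorphic (f : ℂ → ℂ) : Prop :=
  Meromorphic f ∧ ¬ IsRationalFunction f

/-- `u(r) = S(r, f)`: there is a set `E` of positive reals of finite Lebesgue measure such that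
`u(r) = o(T(r, f))` as `r → ∞`, `r ∉ E`, where `T(r, f)` is the Nevanlinna characteristic. -/
def IsSOf (u : ℝ → ℝ) (f : ℂ → ℂ) : Prop :=
  ∃ E : Set ℝ, E ⊆ Set.Ioi 0 ∧ volume E < ⊤ ∧
    Asymptotics.IsLittleO (atTop ⊓ 𝓟 Eᶜ) u (ValueDistribution.characteristic f ⊤)

/-- `b` is a small function of `f`: meromorphic in the plane, not identically zero (as a
meromorphic function), and `T(r, b) = S(r, f)`. -/
def IsSmallFunction (b f : ℂ → ℂ) : Prop :=
  Meromorphic b ∧ ¬ (b =ᶠ[codiscrete ℂ] 0) ∧ IsSOf (ValueDistribution.characteristic b ⊤) f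

/-- The differential monomial `M[f] = a f^{q 0} (f')^{q 1} ⋯ (f^{(k)})^{q k}`. -/
noncomputable def differentialMonomial (a : ℂ → ℂ) (k : ℕ) (q : ℕ → ℕ) (f : ℂ → ℂ) : ℂ → ℂ :=
  fun z => a z * ∏ i ∈ Finset.range (k + 1), (iteratedDeriv i f z) ^ (q i)

/-- `z` is a zero of the meromorphic function `g`, of some multiplicity `m` with `1 ≤ m < ∞`.
(So the function that vanishes identically has no zeros in this sense.) -/
def IsMeromorphicZero (g : ℂ → ℂ) (z : ℂ) : Prop :=
  ∃ m : ℕ, 1 ≤ m ∧ meromorphicOrderAt g z = ((m : ℤ) : WithTop ℤ)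

/-! ### Exceptional sets of radii of finite measure -/

open Topology Set

/-! Write `G = M[f] / φ`, let `d = q 0 + ⋯ + q k`, and suppose that `M[f] - φ` has only finitely
many zeros. With `H = G' / (G - 1)`, the identity `1 / G = 1 - (G' / G) (1 / H)` and the lemma on
the logarithmic derivative give `m(r, 1/G) ≤ m(r, 1/H) + S(r, f)`. Jensen's formula then bounds the
right side by `N(r, H) - N(r, 1/H) + S(r, f)`, because `m(r, H)` is itself small
(`exists_proximity_inv_le`).

This difference is read off pointwise. `H` has only simple poles. They lie at poles of `G`, hence at
poles of `f` or at zeros and poles of `a`, `φ`, or at zeros of `G - 1`, which are zeros of `M[f] -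
φ` or poles of `φ`. At a zero of `f` of order `p`, `G` vanishes to order at least `3p` up to the
orders of `a` and `φ`, so `H` vanishes to order at least `3p - 1 ≥ 2p` up to the same error. Hence
`m(r, 1/G) + 2 N(r, 1/f) ≤ N(r, f) + S(r, f)` (`neg_divisor_logDeriv_le`,
`exists_proximity_inv_add_logCounting_le`).

On the other hand `f^{-d}` is `1 / G` times a product of `a / φ` and powers of the quotients
`f^{(i)} / f`, so `d m(r, 1/f) ≤ m(r, 1/G) + S(r, f)` (`exists_sum_mul_proximity_inv_le`). Since `d
≥ 2`, adding up yields `2 T(r, f) ≤ N(r, f) + S(r, f) ≤ T(r, f) + S(r, f)`, which is absurd. If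
`M[f] = φ` identically, the set of zeros is empty, so this case is refuted too, through the branch
where `G` is constant.

Two classical facts are proved on the way: the lemma on the logarithmic derivative
(`eventually_proximity_logDeriv_le`) and `log r = o(T(r, f))` for transcendental `f`. Both come from
factoring out the zeros and poles in a disc and bounding the logarithmic derivative of the zero-free
factor by a Poisson-type integral. -/

/-- The filter of sets that contain all large reals outside a set of finite measure. -/
noncomputable def atTopOffFinite : Filter ℝ := atTop ⊓ (volume : Measure ℝ).cofinite

/-- A half-line has infinite measure, so it cannot lie in an exceptional set. This lets an
asymptotic inequality off such a set produce a contradiction. -/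
instance atTopOffFinite_neBot : NeBot atTopOffFinite := by
  rw [atTopOffFinite, inf_neBot_iff]
  intro s hs t ht
  obtain ⟨a, ha⟩ := mem_atTop_sets.1 hs
  by_contra h
  have hsub : Ici a ⊆ tᶜ := fun x hx hxt => h ⟨x, ha x hx, hxt⟩
  have h1 := measure_mono (μ := volume) hsub
  rw [Real.volume_Ici, top_le_iff] at h1
  exact (Measure.mem_cofinite.1 ht).ne h1

lemma atTopOffFinite_le_atTop : atTopOffFinite ≤ atTop := inf_le_left

lemma atTopOffFinite_le_cofinite : atTopOffFinite ≤ (volume : Measure ℝ).cofinite := inf_le_right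

lemma atTopOffFinite_le_of_volume_lt_top {E : Set ℝ} (hE : volume E < ⊤) :
    atTopOffFinite ≤ atTop ⊓ 𝓟 Eᶜ := by
  refine inf_le_inf_left _ (le_principal_iff.2 ?_)
  rw [Measure.mem_cofinite, compl_compl]
  exact hE

/-- **Borel's growth lemma**: `T (r + 1 / T r) ≤ 2 T r` outside a set of finite measure. -/
theorem eventually_growth_le_two_mul {T : ℝ → ℝ} (hmono : MonotoneOn T (Ioi 0))
    (hone : ∀ r, 1 ≤ r → 1 ≤ T r) :
    ∀ᶠ r in atTopOffFinite, T (r + (T r)⁻¹) ≤ 2 * T r := by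
  suffices h : {r | 1 ≤ r → T (r + (T r)⁻¹) ≤ 2 * T r} ∈ (volume : Measure ℝ).cofinite by
    filter_upwards [atTopOffFinite_le_cofinite h,
      atTopOffFinite_le_atTop (eventually_ge_atTop (1 : ℝ))] with r h1 h2 using h1 h2
  rw [Measure.mem_cofinite]
  -- Bad radii are sorted by the dyadic size of `T`. If `x < y` both lie in `B j` at distance more
  -- than `2⁻ʲ ≥ 1 / T x`, then `T y > 2 T x ≥ 2 ^ (j + 1)`, which is impossible; so `B j` has
  -- diameter at most `2⁻ʲ`.
  set B : ℕ → Set ℝ := fun j => {r | 1 ≤ r ∧ 2 ^ j ≤ T r ∧ T r < 2 ^ (j + 1) ∧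
    2 * T r < T (r + (T r)⁻¹)} with hB
  have hsub : {r | 1 ≤ r → T (r + (T r)⁻¹) ≤ 2 * T r}ᶜ ⊆ ⋃ j, B j := by
    intro r hr
    simp only [mem_compl_iff, mem_ofPred_eq, Classical.not_imp, not_le] at hr
    obtain ⟨j, h1, h2⟩ := exists_nat_pow_near (hone r hr.1) (one_lt_two (α := ℝ))
    exact mem_iUnion.2 ⟨j, hr.1, h1, h2, hr.2⟩
  have hvol : ∀ j, volume (B j) ≤ ENNReal.ofReal ((1 / 2) ^ j) := by
    intro j
    refine (Real.volume_le_diam _).trans ?_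
    refine Metric.ediam_le fun x hx y hy => ?_
    wlog hxy : x ≤ y generalizing x y
    · rw [edist_comm]; exact this y hy x hx (le_of_not_ge hxy)
    rw [edist_comm, edist_dist, Real.dist_eq, abs_of_nonneg (sub_nonneg.2 hxy)]
    refine ENNReal.ofReal_le_ofReal ?_
    by_contra! hcon
    have hTx : (T x)⁻¹ ≤ (1 / 2) ^ j := by
      rw [one_div, inv_pow]
      exact inv_anti₀ (by positivity) hx.2.1
    have hpos : 0 < (T x)⁻¹ := inv_pos.2 (by linarith [hone x hx.1])
    have h1 : T (x + (T x)⁻¹) ≤ T y := by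
      apply hmono (mem_Ioi.2 (by linarith [hx.1])) (mem_Ioi.2 (by linarith [hy.1])) (by linarith)
    have h2 := hx.2.2.2
    have h3 := hx.2.1
    have h4 := hy.2.2.1
    rw [pow_succ] at h4
    linarith
  calc volume _ ≤ volume (⋃ j, B j) := measure_mono hsub
    _ ≤ ∑' j, volume (B j) := measure_iUnion_le _
    _ ≤ ∑' j : ℕ, ENNReal.ofReal ((1 / 2) ^ j) := ENNReal.tsum_le_tsum hvol
    _ < ⊤ := by
      rw [← ENNReal.ofReal_tsum_of_nonneg (fun _ => by positivity) summable_geometric_two]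
      exact ENNReal.ofReal_lt_top

/-- Outside a set of radii of finite measure, circles stay away from a locally finite set. -/
theorem eventually_inv_sq_le_abs_sub_norm {S : Set ℂ}
    (hS : ∀ R, (S ∩ Metric.closedBall 0 R).Finite) :
    ∀ᶠ r in atTopOffFinite, ∀ a ∈ S,
      (((S ∩ Metric.closedBall 0 ‖a‖).ncard : ℝ) + 1)⁻¹ ^ 2 ≤ |r - ‖a‖| := by
  apply atTopOffFinite_le_cofinite
  rw [Measure.mem_cofinite]
  set ν : ℝ → ℕ := fun t => (S ∩ Metric.closedBall 0 t).ncard with hν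
  set B : ℕ → Set ℝ := fun n => {r | ∃ a ∈ S, ν ‖a‖ = n ∧ |r - ‖a‖| < ((n : ℝ) + 1)⁻¹ ^ 2} with hB
  have hsub : {r | ∀ a ∈ S, ((ν ‖a‖ : ℝ) + 1)⁻¹ ^ 2 ≤ |r - ‖a‖|}ᶜ ⊆ ⋃ n, B n := by
    intro r hr
    simp only [mem_compl_iff, mem_ofPred_eq, not_forall, not_le] at hr
    obtain ⟨a, ha, h⟩ := hr
    exact mem_iUnion.2 ⟨ν ‖a‖, a, ha, rfl, h⟩
  -- The counting function determines the modulus of a point of `S`, so each `B n` lies in a single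
  -- interval, of length `2 / (n + 1) ^ 2`, even when several points share a circle.
  have hinj : ∀ a ∈ S, ∀ b ∈ S, ‖a‖ < ‖b‖ → ν ‖a‖ < ν ‖b‖ := by
    intro a ha b hb hab
    refine Set.ncard_lt_ncard ?_ (hS _)
    refine ⟨inter_subset_inter_right _ (Metric.closedBall_subset_closedBall hab.le), fun h => ?_⟩
    have := (h ⟨hb, by simp⟩).2
    simp only [Metric.mem_closedBall, dist_zero_right] at this
    linarith
  have hvol : ∀ n, volume (B n) ≤ ENNReal.ofReal (2 * ((n : ℝ) + 1)⁻¹ ^ 2) := by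
    intro n
    by_cases hne : ∃ a ∈ S, ν ‖a‖ = n
    · obtain ⟨a, ha, han⟩ := hne
      have : B n ⊆ Metric.ball ‖a‖ (((n : ℝ) + 1)⁻¹ ^ 2) := by
        rintro r ⟨b, hb, hbn, hr⟩
        have hab : ‖a‖ = ‖b‖ := by
          rcases lt_trichotomy ‖a‖ ‖b‖ with h | h | h
          · have := hinj a ha b hb h; omega
          · exact h
          · have := hinj b hb a ha h; omega
        rw [Metric.mem_ball, Real.dist_eq, hab]
        exact hr
      exact (measure_mono this).trans (by rw [Real.volume_ball])
    · have : B n = ∅ := by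
        ext r; simp only [hB, mem_ofPred_eq, mem_empty_iff_false, iff_false]
        rintro ⟨b, hb, hbn, -⟩; exact hne ⟨b, hb, hbn⟩
      simp [this]
  have hsum : Summable fun n : ℕ => 2 * ((n : ℝ) + 1)⁻¹ ^ 2 := by
    have := (summable_nat_add_iff 1).2 (Real.summable_nat_pow_inv.2 (one_lt_two))
    refine (this.mul_left 2).congr fun n => ?_
    push_cast
    rw [inv_pow]
  calc volume _ ≤ volume (⋃ j, B j) := measure_mono hsub
    _ ≤ ∑' j, volume (B j) := measure_iUnion_le _
    _ ≤ ∑' n : ℕ, ENNReal.ofReal (2 * ((n : ℝ) + 1)⁻¹ ^ 2) := ENNReal.tsum_le_tsum hvol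
    _ < ⊤ := by
      rw [← ENNReal.ofReal_tsum_of_nonneg (fun _ => by positivity) hsum]
      exact ENNReal.ofReal_lt_top

/-! ### Logarithmic derivatives of zero-free functions on a disc -/

open Topology Set Metric Real MeromorphicOn ValueDistribution

lemma norm_circleAverage_le_circleAverage_norm {h : ℂ → ℂ} {c : ℂ} {R : ℝ} :
    ‖circleAverage h c R‖ ≤ circleAverage (fun z => ‖h z‖) c R := by
  rw [circleAverage, circleAverage, norm_smul, smul_eq_mul, Real.norm_of_nonneg (by positivity)]
  gcongr
  exact intervalIntegral.norm_integral_le_integral_norm two_pi_pos.le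

/-- The logarithmic derivative of a nonvanishing analytic function on a disc, as an integral of
`log ‖g‖` over the boundary circle. -/
theorem logDeriv_eq_circleAverage {g : ℂ → ℂ} {R : ℝ} {w : ℂ}
    (hg : AnalyticOnNhd ℂ g (closedBall 0 R)) (hne : ∀ u ∈ closedBall (0 : ℂ) R, g u ≠ 0)
    (hw : w ∈ ball (0 : ℂ) R) :
    logDeriv g w = circleAverage (fun ζ => (2 * ζ / (ζ - w) ^ 2) • ((Real.log ‖g ζ‖ : ℝ) : ℂ)) 0 R := by
  have hR : 0 < R := pos_of_mem_ball hw
  have hharm : InnerProductSpace.HarmonicOnNhd (fun z => Real.log ‖g z‖) (closedBall 0 R) :=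
    fun x hx => (hg x hx).harmonicAt_log_norm (hne x hx)
  have hint : CircleIntegrable (fun z => Real.log ‖g z‖) 0 R := by
    refine ContinuousOn.circleIntegrable hR.le ?_
    refine ContinuousOn.log (hg.continuousOn.mono sphere_subset_closedBall).norm fun x hx => ?_
    exact norm_ne_zero_iff.2 (hne x (sphere_subset_closedBall hx))
  have hintC : CircleIntegrable (fun z => ((Real.log ‖g z‖ : ℝ) : ℂ)) 0 R := by
    simp only [CircleIntegrable, intervalIntegrable_iff] at hint ⊢
    exact Complex.ofRealCLM.integrable_comp hint
  set F : ℂ → ℂ := fun w =>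
    circleAverage (fun ζ => herglotzRieszKernel 0 w ζ • ((Real.log ‖g ζ‖ : ℝ) : ℂ)) 0 R with hF
  have hFd : ∀ x ∈ ball (0 : ℂ) R, HasDerivAt F
      (circleAverage (fun ζ => (2 * ζ / (ζ - x) ^ 2) • ((Real.log ‖g ζ‖ : ℝ) : ℂ)) 0 R) x :=
    fun x hx => hasDerivAt_circleAverage_herglotzRieszKernel_smul hintC hx
  have hre : ∀ x ∈ ball (0 : ℂ) R, (F x).re = Real.log ‖g x‖ := by
    intro x hx
    rw [hF]
    simp only
    rw [re_circleAverage_herglotzRieszKernel_smul hint hx]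
    exact hharm.circleAverage_re_herglotzRieszKernel_smul hx
  -- `F` is holomorphic with real part `log ‖g‖`, so `g exp (-F)` has modulus one and is locally
  -- constant by the maximum principle. Differentiating gives `g' / g = F'`.
  set k : ℂ → ℂ := fun z => g z * Complex.exp (-F z) with hk
  have hk1 : ∀ x ∈ ball (0 : ℂ) R, ‖k x‖ = 1 := by
    intro x hx
    have hgx := norm_pos_iff.2 (hne x (ball_subset_closedBall hx))
    rw [hk]
    simp only
    rw [norm_mul, Complex.norm_exp, Complex.neg_re, hre x hx, Real.exp_neg, Real.exp_log hgx,
      mul_inv_cancel₀ hgx.ne']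
  have hgd : ∀ x ∈ ball (0 : ℂ) R, DifferentiableAt ℂ g x :=
    fun x hx => (hg x (ball_subset_closedBall hx)).differentiableAt
  have hnear : ∀ᶠ z in 𝓝 w, z ∈ ball (0 : ℂ) R := isOpen_ball.mem_nhds hw
  have hconst : ∀ᶠ z in 𝓝 w, k z = k w := by
    apply Complex.eventually_eq_of_isLocalMax_norm
    · filter_upwards [hnear] with z hz
      exact (hgd z hz).mul (hFd z hz).differentiableAt.neg.cexp
    · filter_upwards [hnear] with z hz
      simp only [Function.comp, hk1 z hz, hk1 w hw, le_refl]
  have hder := ((hgd w hw).hasDerivAt.mul ((hFd w hw).neg.cexp)).unique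
    ((hasDerivAt_const w (k w)).congr_of_eventuallyEq hconst)
  have hexp := Complex.exp_ne_zero (-F w)
  rw [logDeriv_apply, div_eq_iff (hne w (ball_subset_closedBall hw))]
  apply mul_right_cancel₀ hexp
  linear_combination hder

/-- On the circle `‖ζ‖ = R` the kernel `2ζ / (ζ - w)²` has modulus at most `2R / (R - ‖w‖)²`. -/
theorem norm_logDeriv_le_circleAverage {g : ℂ → ℂ} {R : ℝ} {w : ℂ}
    (hg : AnalyticOnNhd ℂ g (closedBall 0 R)) (hne : ∀ u ∈ closedBall (0 : ℂ) R, g u ≠ 0)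
    (hw : w ∈ ball (0 : ℂ) R) :
    ‖logDeriv g w‖ ≤ 2 * R / (R - ‖w‖) ^ 2 * circleAverage (fun z => |Real.log ‖g z‖|) 0 R := by
  have hR : 0 < R := pos_of_mem_ball hw
  have hw' : ‖w‖ < R := by simpa using hw
  have hcont : ContinuousOn (fun z => Real.log ‖g z‖) (sphere 0 R) := by
    refine ContinuousOn.log (hg.continuousOn.mono sphere_subset_closedBall).norm fun x hx => ?_
    exact norm_ne_zero_iff.2 (hne x (sphere_subset_closedBall hx))
  rw [logDeriv_eq_circleAverage hg hne hw, ← smul_eq_mul, ← circleAverage_fun_smul]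
  refine norm_circleAverage_le_circleAverage_norm.trans (circleAverage_mono ?_ ?_ ?_)
  · refine ContinuousOn.circleIntegrable hR.le ?_
    refine ContinuousOn.norm (ContinuousOn.fun_smul ?_ (Complex.continuous_ofReal.comp_continuousOn hcont))
    refine ContinuousOn.div (by fun_prop) (by fun_prop) fun x hx => ?_
    refine pow_ne_zero _ (sub_ne_zero.2 ?_)
    rintro rfl
    simp at hx; linarith
  · exact (ContinuousOn.circleIntegrable hR.le (by fun_prop))
  · intro x hx
    rw [abs_of_pos hR] at hx
    have hx' : ‖x‖ = R := by simpa using hx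
    rw [norm_smul, smul_eq_mul, Complex.norm_real, Real.norm_eq_abs, norm_div, norm_mul, norm_pow,
      hx', Complex.norm_ofNat]
    have : R - ‖w‖ ≤ ‖x - w‖ := by rw [← hx']; exact norm_sub_norm_le x w
    have h2 : 0 < R - ‖w‖ := by linarith
    gcongr

/-- Since `|log x| = 2 log⁺ x - log x`, an upper bound for `log⁺` suffices: the mean of `log ‖z -
u‖` is exactly `log R` for `u` in the closed disc. -/
lemma circleAverage_abs_log_norm_sub_le {R : ℝ} (hR : 1 ≤ R) {u : ℂ} (hu : u ∈ closedBall (0 : ℂ) R) :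
    circleAverage (fun z => |Real.log ‖z - u‖|) 0 R ≤ 2 * Real.log (2 * R) := by
  have hR0 : 0 < R := by linarith
  have hmer : MeromorphicOn (fun z : ℂ => z - u) (sphere 0 |R|) := fun x _ => by fun_prop
  have h1 : (fun z : ℂ => |Real.log ‖z - u‖|) =
      fun z => (2 : ℝ) • log⁺ ‖z - u‖ - Real.log ‖z - u‖ := by
    ext z
    rw [smul_eq_mul, ← half_mul_log_add_log_abs]
    ring
  have hu' : u ∈ closedBall (0 : ℂ) |R| := by rwa [abs_of_pos hR0]
  rw [h1, circleAverage_fun_sub hmer.circleIntegrable_posLog_norm.const_fun_smul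
    (circleIntegrable_log_norm_sub_const R), circleAverage_fun_smul,
    circleAverage_log_norm_sub_const_of_mem_closedBall hu', smul_eq_mul]
  have h2 : circleAverage (fun z => log⁺ ‖z - u‖) 0 R ≤ Real.log (2 * R) := by
    apply circleAverage_mono_on_of_le_circle hmer.circleIntegrable_posLog_norm
    intro x hx
    have hx' : ‖x‖ = R := by simpa [abs_of_pos hR0] using hx
    have hu'' : ‖u‖ ≤ R := by simpa using hu
    rw [← posLog_eq_log (by rw [abs_of_pos] <;> linarith)]
    apply posLog_le_posLog (norm_nonneg _)
    linarith [norm_sub_le x u]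
  have := Real.log_nonneg hR
  linarith

/-- If `f` is the product of a nonvanishing analytic function `g` and a rational function, then
the logarithmic derivative of `g` is controlled by the proximity functions of `f` and `1 / f`. -/
theorem norm_logDeriv_le_of_log_norm_eq {f g : ℂ → ℂ} (hf : Meromorphic f) {R : ℝ} (hR : 1 ≤ R)
    (hg : AnalyticOnNhd ℂ g (closedBall 0 R)) (hne : ∀ u ∈ closedBall (0 : ℂ) R, g u ≠ 0)
    {D : ℂ → ℤ} {s : Finset ℂ} (hs : ∀ u ∈ s, u ∈ closedBall (0 : ℂ) R)
    (hlog : (fun z => Real.log ‖f z‖) =ᶠ[codiscreteWithin (closedBall 0 R)]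
      fun z => ∑ u ∈ s, D u * Real.log ‖z - u‖ + Real.log ‖g z‖) {w : ℂ} (hw : w ∈ ball 0 R) :
    ‖logDeriv g w‖ ≤ 2 * R / (R - ‖w‖) ^ 2 * (proximity f ⊤ R + proximity f⁻¹ ⊤ R +
      (∑ u ∈ s, |(D u : ℝ)|) * (2 * Real.log (2 * R))) := by
  have hR0 : 0 < R := by linarith
  have hw' : ‖w‖ < R := by simpa using hw
  refine (norm_logDeriv_le_circleAverage hg hne hw).trans ?_
  refine mul_le_mul_of_nonneg_left ?_ (by positivity)
  have hi1 : CircleIntegrable (fun z => |Real.log ‖f z‖|) 0 R :=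
    (hf.meromorphicOn (s := sphere 0 |R|)).circleIntegrable_log_norm.abs
  have hi2 : ∀ u ∈ s, CircleIntegrable (fun z => |(D u : ℝ)| • |Real.log ‖z - u‖|) 0 R :=
    fun u hu => (circleIntegrable_log_norm_sub_const R).abs.const_fun_smul
  have hi3 : CircleIntegrable (fun z => ∑ u ∈ s, |(D u : ℝ)| • |Real.log ‖z - u‖|) 0 R := by
    simpa [Finset.sum_fn] using CircleIntegrable.sum s hi2
  -- This is `|log x| = log⁺ x + log⁺ (1 / x)`, averaged over the circle.
  have hproxf : circleAverage (fun z => |Real.log ‖f z‖|) 0 R =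
      proximity f ⊤ R + proximity f⁻¹ ⊤ R := by
    rw [proximity_top, proximity_top, ← circleAverage_add
      hf.meromorphicOn.circleIntegrable_posLog_norm
      hf.inv.meromorphicOn.circleIntegrable_posLog_norm]
    congr 1
    ext z
    simp only [Pi.add_apply, Pi.inv_apply, norm_inv]
    rw [← half_mul_log_add_log_abs, ← half_mul_log_add_log_abs, Real.log_inv, abs_neg]
    ring
  have hcd : (fun z => |Real.log ‖g z‖|) =ᶠ[codiscreteWithin (sphere 0 |R|)]
      fun z => |Real.log ‖f z‖ - ∑ u ∈ s, D u * Real.log ‖z - u‖| := by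
    have hm : sphere (0 : ℂ) |R| ⊆ closedBall 0 R := by
      rw [abs_of_pos hR0]; exact sphere_subset_closedBall
    filter_upwards [hlog.filter_mono (codiscreteWithin_mono hm)] with z hz
    rw [hz, add_sub_cancel_left]
  rw [circleAverage_congr_codiscreteWithin hcd hR0.ne', ← hproxf]
  calc _ ≤ circleAverage (fun z => |Real.log ‖f z‖| + ∑ u ∈ s, |(D u : ℝ)| • |Real.log ‖z - u‖|) 0 R := by
        refine circleAverage_mono ?_ (hi1.add hi3) fun z _ => ?_
        · have : CircleIntegrable (fun z => ∑ u ∈ s, (D u : ℝ) * Real.log ‖z - u‖) 0 R := by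
            have := CircleIntegrable.sum s (f := fun u z => (D u : ℝ) • Real.log ‖z - u‖)
              (c := 0) (R := R)
              (fun u hu => (circleIntegrable_log_norm_sub_const R).const_fun_smul)
            simpa [Finset.sum_fn] using this
          exact ((hf.meromorphicOn (s := sphere 0 |R|)).circleIntegrable_log_norm.sub this).abs
        · refine (abs_sub _ _).trans ?_
          gcongr
          refine (Finset.abs_sum_le_sum_abs _ _).trans_eq ?_
          simp [abs_mul]
    _ = _ + ∑ u ∈ s, |(D u : ℝ)| • circleAverage (fun z => |Real.log ‖z - u‖|) 0 R := by
        rw [circleAverage_fun_add hi1 hi3, circleAverage_fun_sum hi2]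
        congr 2
        ext u
        rw [circleAverage_fun_smul]
    _ ≤ _ := by
        gcongr
        rw [Finset.sum_mul]
        refine Finset.sum_le_sum fun u hu => ?_
        rw [smul_eq_mul]
        gcongr
        exact circleAverage_abs_log_norm_sub_le hR (hs u hu)

/-! ### Factoring out zeros and poles, and counting them -/

lemma log_norm_eq_sum_of_factorization {U : Set ℂ} {f g : ℂ → ℂ}
    {D : Function.locallyFinsuppWithin U ℤ} (hD : D.support.Finite) (hne : ∀ u : U, g u ≠ 0)
    (hfg : f =ᶠ[codiscreteWithin U] (∏ᶠ u, (· - u) ^ D u) • g) :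
    (fun z => Real.log ‖f z‖) =ᶠ[codiscreteWithin U]
      fun z => ∑ u ∈ hD.toFinset, D u * Real.log ‖z - u‖ + Real.log ‖g z‖ := by
  filter_upwards [MeromorphicOn.extract_zeros_poles_log (D := D) hne hfg] with z hz
  rw [hz, finsum_eq_sum_of_support_subset (s := hD.toFinset)]
  · simp [Finset.sum_apply]
  · intro u hu
    rw [hD.coe_toFinset]
    contrapose! hu
    have : D u = 0 := by simpa using hu
    simp only [Function.mem_support, this, Int.cast_zero, zero_mul, not_not]
    rfl

/-- Decomposition of the logarithmic derivative of a meromorphic function on a disc, with a bound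
for the part without poles. -/
theorem exists_logDeriv_decomposition {f : ℂ → ℂ} (hf : Meromorphic f)
    (hf' : ∀ z, meromorphicOrderAt f z ≠ ⊤) {R : ℝ} (hR : 1 ≤ R) :
    ∃ g : ℂ → ℂ, logDeriv f =ᶠ[codiscreteWithin (ball 0 R)]
        (fun z => ∑ᶠ u, (divisor f (closedBall 0 R) u : ℂ) * (z - u)⁻¹ + logDeriv g z) ∧
      ∀ w ∈ ball (0 : ℂ) R, ‖logDeriv g w‖ ≤ 2 * R / (R - ‖w‖) ^ 2 *
        (proximity f ⊤ R + proximity f⁻¹ ⊤ R +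
          (∑ᶠ u, |(divisor f (closedBall 0 R) u : ℝ)|) * (2 * Real.log (2 * R))) := by
  have hR0 : 0 < R := by linarith
  set D := divisor f (closedBall 0 R) with hD
  have hfin : D.support.Finite := D.finiteSupport (isCompact_closedBall 0 R)
  obtain ⟨g, hg, hne, hfg⟩ := (hf.meromorphicOn (s := closedBall 0 R)).extract_zeros_poles
    (fun u => hf' u) hfin
  have hne' : ∀ u ∈ closedBall (0 : ℂ) R, g u ≠ 0 := fun u hu => hne ⟨u, hu⟩
  refine ⟨g, ?_, fun w hw => ?_⟩
  · have h1 := logDeriv_congr_codiscreteWithin isOpen_ball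
      (hfg.filter_mono (codiscreteWithin_mono (ball_subset_closedBall (x := (0 : ℂ)) (ε := R))))
    have hmer : MeromorphicOn (∏ᶠ u, (fun z : ℂ => z - u) ^ D u) (ball 0 R) :=
      (Function.FactorizedRational.meromorphicNFOn D _).meromorphicOn
    have h2 := hmer.logDeriv_mul_eventuallyEq (hg.mono ball_subset_closedBall).meromorphicOn
      (fun x _ => Function.FactorizedRational.meromorphicOrderAt_ne_top D) (fun x hx => by
        have hx' := ball_subset_closedBall hx
        rw [((hg x hx').meromorphicNFAt.meromorphicOrderAt_eq_zero_iff).2 (hne' x hx')]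
        simp)
    have h3 := MeromorphicOn.logDeriv_finprod_zpow_eventuallyEq (U := ball (0 : ℂ) R)
      (F := fun (u : ℂ) (z : ℂ) => z - u) (d := D) hfin (fun i x _ => by fun_prop) (fun i x _ => by
        rw [ne_eq, meromorphicOrderAt_eq_top_iff]
        intro h
        have h2 : ∀ᶠ z in 𝓝[≠] x, z ≠ i := by
          by_cases hxi : x = i
          · rw [hxi]; exact self_mem_nhdsWithin
          · exact eventually_nhdsWithin_of_eventually_nhds (eventually_ne_nhds hxi)
        obtain ⟨z, hz1, hz2⟩ := (h.and h2).exists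
        exact hz2 (sub_eq_zero.1 hz1))
    filter_upwards [h1, h2, h3] with z hz1 hz2 hz3
    rw [hz1, smul_eq_mul, hz2, Pi.add_apply, hz3]
    congr 2
    ext u
    rw [zsmul_eq_mul, logDeriv_apply]
    simp
  · have hsub : ∀ u ∈ hfin.toFinset, u ∈ closedBall (0 : ℂ) R := fun u hu =>
      D.supportWithinDomain (hfin.mem_toFinset.1 hu)
    have hsupp : ∀ u ∉ hfin.toFinset, D u = 0 := fun u hu => by
      simpa [hfin.mem_toFinset] using hu
    rw [finsum_eq_sum_of_support_subset (s := hfin.toFinset)]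
    · refine norm_logDeriv_le_of_log_norm_eq hf hR hg hne' hsub ?_ hw
      exact log_norm_eq_sum_of_factorization hfin hne hfg
    · intro u hu
      contrapose! hu
      simp [hsupp u hu]

/-- A point `u` of the smaller disc contributes `log R' - log ‖u‖ ≥ log R' - log R` per unit of
multiplicity. At `u = 0` the convention `log 0 = 0` is harmless because `R ≥ 1`. -/
lemma sum_mul_log_le_logCounting {D : Function.locallyFinsupp ℂ ℤ} (hD : 0 ≤ D) {R R' : ℝ}
    (hR : 1 ≤ R) (hRR : R < R') {s : Finset ℂ} (hs : ∀ u ∈ s, u ∈ closedBall (0 : ℂ) R) :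
    (∑ u ∈ s, (D u : ℝ)) * (Real.log R' - Real.log R) ≤
      Function.locallyFinsuppWithin.logCounting D R' := by
  classical
  set E : Function.locallyFinsupp ℂ ℤ :=
    ∑ u ∈ s, Function.locallyFinsuppWithin.single u (D u) with hE
  have hle : E ≤ D := by
    intro z
    rw [hE, Function.locallyFinsuppWithin.coe_sum, Finset.sum_apply]
    simp only [Function.locallyFinsuppWithin.single_apply]
    rw [Finset.sum_ite_eq]
    split_ifs
    · exact le_rfl
    · exact hD z
  refine le_trans ?_ (Function.locallyFinsuppWithin.logCounting_le hle (by linarith))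
  rw [hE, map_sum, Finset.sum_apply, Finset.sum_mul]
  refine Finset.sum_le_sum fun u hu => ?_
  have hu' : ‖u‖ ≤ R := by simpa using hs u hu
  rw [Function.locallyFinsuppWithin.logCounting_single_eq_log_sub_const (by linarith)]
  have h0 : (0 : ℝ) ≤ D u := by exact_mod_cast hD u
  have : Real.log ‖u‖ ≤ Real.log R := by
    rcases (norm_nonneg u).eq_or_lt with h | h
    · rw [← h, Real.log_zero]; exact Real.log_nonneg hR
    · exact Real.log_le_log h hu'
  gcongr

/-- The number of zeros and poles of `f` in a closed disc, counted with multiplicities, is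
controlled by the logarithmic counting functions at a larger radius. -/
lemma finsum_abs_divisor_le {f : ℂ → ℂ} (hf : Meromorphic f) {R R' : ℝ} (hR : 1 ≤ R)
    (hRR : R < R') :
    (∑ᶠ u, |(divisor f (closedBall 0 R) u : ℝ)|) * ((R' - R) / R') ≤
      logCounting f 0 R' + logCounting f ⊤ R' := by
  set D := divisor f (closedBall 0 R) with hD
  have hfin : D.support.Finite := D.finiteSupport (isCompact_closedBall 0 R)
  set s := hfin.toFinset with hs
  have hsub : ∀ u ∈ s, u ∈ closedBall (0 : ℂ) R := fun u hu =>
    D.supportWithinDomain (hfin.mem_toFinset.1 hu)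
  set E : Function.locallyFinsupp ℂ ℤ := (divisor f univ)⁺ + (divisor f univ)⁻ with hE
  have hE0 : 0 ≤ E := add_nonneg (posPart_nonneg _) (negPart_nonneg _)
  have hDE : ∀ u ∈ s, |(D u : ℝ)| = E u := by
    intro u hu
    rw [hE, Function.locallyFinsuppWithin.coe_add, Pi.add_apply,
      Function.locallyFinsuppWithin.posPart_apply, Function.locallyFinsuppWithin.negPart_apply,
      posPart_add_negPart, hD, divisor_apply hf.meromorphicOn (hsub u hu),
      divisor_apply hf.meromorphicOn (mem_univ u)]
    push_cast
    rfl
  rw [finsum_eq_sum_of_support_subset (s := s), Finset.sum_congr rfl hDE]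
  · have h1 := sum_mul_log_le_logCounting hE0 hR hRR hsub
    rw [hE, map_add, Pi.add_apply, ← logCounting_zero, ← logCounting_top] at h1
    refine le_trans ?_ h1
    refine mul_le_mul_of_nonneg_left ?_ (Finset.sum_nonneg fun u _ => by exact_mod_cast hE0 u)
    rw [← Real.log_div (by linarith) (by linarith)]
    -- `log (R' / R) ≥ 1 - R / R'`.
    refine le_trans (le_of_eq ?_)
      (Real.one_sub_inv_le_log_of_pos (div_pos (by linarith : 0 < R') (by linarith : 0 < R)))
    have h1 : R' ≠ 0 := by linarith
    field_simp
  · intro u hu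
    rw [hs, hfin.coe_toFinset]
    contrapose! hu
    have : D u = 0 := by simpa using hu
    simp [this]

/-! ### The lemma on the logarithmic derivative -/

/-- The sum of the characteristic functions of `f` and `1 / f`, normalised to be at least one. -/
noncomputable def totalCharacteristic (f : ℂ → ℂ) (r : ℝ) : ℝ :=
  1 + characteristic f ⊤ r + characteristic f⁻¹ ⊤ r

lemma totalCharacteristic_monotoneOn {f : ℂ → ℂ} (hf : Meromorphic f) :
    MonotoneOn (totalCharacteristic f) (Ioi 0) := by
  intro x hx y hy hxy
  have h1 := characteristic_monotoneOn hf hx hy hxy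
  have h2 := characteristic_monotoneOn hf.inv hx hy hxy
  unfold totalCharacteristic
  linarith

lemma one_le_totalCharacteristic (f : ℂ → ℂ) {r : ℝ} (hr : 1 ≤ r) :
    1 ≤ totalCharacteristic f r := by
  have h1 := characteristic_nonneg (f := f) (a := ⊤) hr
  have h2 := characteristic_nonneg (f := f⁻¹) (a := ⊤) hr
  unfold totalCharacteristic
  linarith

lemma logCounting_add_logCounting_le_totalCharacteristic (f : ℂ → ℂ) (r : ℝ) :
    logCounting f 0 r + logCounting f ⊤ r ≤ totalCharacteristic f r := by
  have h1 := proximity_nonneg (f := f) (a := ⊤) r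
  have h2 := proximity_nonneg (f := f⁻¹) (a := ⊤) r
  simp only [totalCharacteristic, characteristic, Pi.add_apply, logCounting_inv]
  simp only [Pi.zero_apply] at h1 h2
  linarith

lemma proximity_add_proximity_le_totalCharacteristic (f : ℂ → ℂ) {r : ℝ} (hr : 1 ≤ r) :
    proximity f ⊤ r + proximity f⁻¹ ⊤ r ≤ totalCharacteristic f r := by
  have h1 := logCounting_nonneg (f := f) (e := ⊤) hr
  have h2 := logCounting_nonneg (f := f⁻¹) (e := ⊤) hr
  simp only [totalCharacteristic, characteristic, Pi.add_apply]
  linarith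

/-- **Lemma on the logarithmic derivative**, in terms of `totalCharacteristic`. -/
theorem eventually_proximity_logDeriv_le {f : ℂ → ℂ} (hf : Meromorphic f)
    (hf' : ∀ z, meromorphicOrderAt f z ≠ ⊤) :
    ∀ᶠ r in atTopOffFinite, proximity (logDeriv f) ⊤ r ≤
      Real.log 269 + 6 * Real.log (totalCharacteristic f r) + 3 * Real.log (r + 1) := by
  set T := totalCharacteristic f with hT
  set S := (divisor f univ).support with hS
  have hSfin : ∀ R, (S ∩ closedBall 0 R).Finite := fun R => by
    rw [inter_comm]
    exact LocallyFiniteSupport.finite_inter_support_of_isCompact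
      (Function.locallyFinsupp.locallyFiniteSupport _) (isCompact_closedBall 0 R)
  filter_upwards [eventually_growth_le_two_mul (totalCharacteristic_monotoneOn hf)
      (fun r hr => one_le_totalCharacteristic f hr), eventually_inv_sq_le_abs_sub_norm hSfin,
    atTopOffFinite_le_atTop (eventually_ge_atTop (1 : ℝ))] with r hgrow havoid hr
  rw [← hT] at hgrow
  set t := T r with ht
  have ht1 : 1 ≤ t := one_le_totalCharacteristic f hr
  have ht0 : 0 < t⁻¹ := by positivity
  have ht2 : t⁻¹ ≤ 1 := inv_le_one_of_one_le₀ ht1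
  -- Two radii are needed: the factorization is made on the disc of radius `R`, and its zeros and
  -- poles are counted by logarithmic counting functions at `R'`. Borel's lemma keeps `T R'` below
  -- `2 t`, while each gap is `1 / (2 t)`, so only powers of `t` are lost.
  set R := r + t⁻¹ / 2 with hRdef
  set R' := r + t⁻¹ with hR'def
  have hR : 1 ≤ R := by linarith
  have hRR : R < R' := by linarith
  have hRr : r < R := by linarith
  obtain ⟨g, hdec, hg⟩ := exists_logDeriv_decomposition hf hf' hR
  set D := divisor f (closedBall 0 R) with hD
  set n := ∑ᶠ u, |(D u : ℝ)| with hn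
  have hfin : D.support.Finite := D.finiteSupport (isCompact_closedBall 0 R)
  set s := hfin.toFinset with hs
  have hsub : ∀ u ∈ s, u ∈ closedBall (0 : ℂ) R := fun u hu =>
    D.supportWithinDomain (hfin.mem_toFinset.1 hu)
  have hnsum : n = ∑ u ∈ s, |(D u : ℝ)| := by
    rw [hn, finsum_eq_sum_of_support_subset (s := s)]
    intro u hu
    rw [hs, hfin.coe_toFinset]
    contrapose! hu
    have : D u = 0 := by simpa using hu
    simp [this]
  have hn0 : 0 ≤ n := by rw [hnsum]; positivity
  have hTR' : T R' ≤ 2 * t := hgrow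
  have hnle : n ≤ 4 * t ^ 2 * (r + 1) := by
    have h1 := (finsum_abs_divisor_le hf hR hRR).trans
      ((logCounting_add_logCounting_le_totalCharacteristic f R').trans hTR')
    rw [← hn, show R' - R = t⁻¹ / 2 by simp only [hRdef, hR'def]; ring] at h1
    have hR'0 : 0 < R' := by linarith
    have h2 : n = n * (t⁻¹ / 2 / R') * (2 * t * R') := by field_simp
    rw [h2]
    calc _ ≤ 2 * t * (2 * t * R') := by gcongr
      _ ≤ 2 * t * (2 * t * (r + 1)) := by gcongr; linarith
      _ = _ := by ring
  have hDS : ∀ u ∈ closedBall (0 : ℂ) R, D u = divisor f univ u := by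
    intro u hu
    rw [hD, divisor_apply hf.meromorphicOn hu, divisor_apply hf.meromorphicOn (mem_univ u)]
  have hdist : ∀ z : ℂ, ‖z‖ = r → ∀ u ∈ s, ‖(z - u)⁻¹‖ ≤ (n + 1) ^ 2 := by
    intro z hz u hu
    have huS : u ∈ S := by
      have := hfin.mem_toFinset.1 hu
      rw [hS]
      intro h
      exact this (by rw [hDS u (hsub u hu)]; exact h)
    have huR : ‖u‖ ≤ R := by simpa using hsub u hu
    have h1 := havoid u huS
    -- Distinct points are at most as many as points with multiplicity, so the avoidance bound may
    -- be weakened to one depending only on `n`.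
    have h2 : ((S ∩ closedBall 0 ‖u‖).ncard : ℝ) ≤ n := by
      have hsubset : S ∩ closedBall 0 ‖u‖ ⊆ (s : Set ℂ) := by
        rintro v ⟨hv1, hv2⟩
        have hvR := closedBall_subset_closedBall huR hv2
        rw [hs, hfin.coe_toFinset]
        intro h
        exact hv1 (by rw [← hDS v hvR]; exact h)
      have h3 : (S ∩ closedBall 0 ‖u‖).ncard ≤ s.card := by
        rw [← Set.ncard_coe_finset]
        exact Set.ncard_le_ncard hsubset s.finite_toSet
      refine (Nat.cast_le.2 h3).trans ?_
      rw [hnsum, Finset.card_eq_sum_ones]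
      push_cast
      refine Finset.sum_le_sum fun v hv => ?_
      have hv0 : D v ≠ 0 := hfin.mem_toFinset.1 hv
      exact_mod_cast Int.one_le_abs hv0
    have h4 : |r - ‖u‖| ≤ ‖z - u‖ := by rw [← hz]; exact abs_norm_sub_norm_le z u
    have h5 : (n + 1)⁻¹ ^ 2 ≤ ‖z - u‖ := by
      refine le_trans ?_ (h1.trans h4)
      gcongr
    rw [norm_inv]
    refine inv_le_of_inv_le₀ (by positivity) ?_
    rw [← inv_pow]; exact h5
  set h : ℂ → ℂ := fun z => ∑ᶠ u, (D u : ℂ) * (z - u)⁻¹ + logDeriv g z with hh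
  -- The bound is pointwise on the whole circle, so `log⁺` can be applied before averaging. The
  -- constant is `125 + 144`: the first term comes from the sum over zeros and poles, the second
  -- from the zero-free factor.
  have hbound : ∀ z ∈ sphere (0 : ℂ) |r|, ‖h z‖ ≤ 269 * t ^ 6 * (r + 1) ^ 3 := by
    intro z hz
    have hz : ‖z‖ = r := by simpa [abs_of_pos (by linarith : 0 < r)] using hz
    have hb1 : ‖∑ᶠ u, (D u : ℂ) * (z - u)⁻¹‖ ≤ n * (n + 1) ^ 2 := by
      rw [finsum_eq_sum_of_support_subset (s := s)]
      · rw [hnsum, Finset.sum_mul, ← hnsum]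
        refine (norm_sum_le _ _).trans (Finset.sum_le_sum fun u hu => ?_)
        rw [norm_mul, Complex.norm_intCast]
        gcongr
        exact hdist z hz u hu
      · intro u hu
        rw [hs, hfin.coe_toFinset]
        contrapose! hu
        have : D u = 0 := by simpa using hu
        simp [this]
    have hb2 := hg z (by simpa [hz] using hRr)
    rw [hz, show R - r = t⁻¹ / 2 by simp [hRdef]] at hb2
    have hprox : proximity f ⊤ R + proximity f⁻¹ ⊤ R ≤ 2 * t :=
      (proximity_add_proximity_le_totalCharacteristic f hR).trans
        ((totalCharacteristic_monotoneOn hf (mem_Ioi.2 (by linarith)) (mem_Ioi.2 (by linarith))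
          hRR.le).trans hTR')
    have hlog : 2 * Real.log (2 * R) ≤ 4 * (r + 1) := by
      have := Real.log_le_sub_one_of_pos (show 0 < 2 * R by linarith)
      linarith
    have hρ : 1 ≤ r + 1 := by linarith
    have hb3 : ‖logDeriv g z‖ ≤ 144 * t ^ 6 * (r + 1) ^ 3 := by
      refine hb2.trans ?_
      calc _ ≤ 2 * (r + 1) / (t⁻¹ / 2) ^ 2 * (2 * t + (4 * t ^ 2 * (r + 1)) * (4 * (r + 1))) := by
            have h1 := add_nonneg (proximity_nonneg (f := f) (a := ⊤) R)
              (proximity_nonneg (f := f⁻¹) (a := ⊤) R)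
            have h2 : 0 ≤ 2 * Real.log (2 * R) :=
              mul_nonneg zero_le_two (Real.log_nonneg (by linarith))
            gcongr
            linarith
        _ = 8 * (r + 1) * t ^ 2 * (2 * (t * (1 * 1)) + 16 * (t ^ 2 * (r + 1) ^ 2)) := by
            field_simp; ring
        _ ≤ 8 * (r + 1) * t ^ 2 * (2 * (t ^ 2 * (r + 1) ^ 2) + 16 * (t ^ 2 * (r + 1) ^ 2)) := by
            gcongr
            · nlinarith
            · nlinarith
        _ = 144 * t ^ 4 * (r + 1) ^ 3 := by ring
        _ ≤ 144 * t ^ 6 * (r + 1) ^ 3 := by gcongr; norm_num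
    have hb4 : n * (n + 1) ^ 2 ≤ 125 * t ^ 6 * (r + 1) ^ 3 := by
      have h1 : n + 1 ≤ 5 * t ^ 2 * (r + 1) := by
        have : 1 ≤ t ^ 2 * (r + 1) := one_le_mul_of_one_le_of_one_le (one_le_pow₀ ht1) hρ
        linarith
      calc n * (n + 1) ^ 2 ≤ (5 * t ^ 2 * (r + 1)) * (5 * t ^ 2 * (r + 1)) ^ 2 := by
            gcongr; linarith
        _ = _ := by ring
    calc ‖h z‖ ≤ _ := norm_add_le _ _
      _ ≤ 125 * t ^ 6 * (r + 1) ^ 3 + 144 * t ^ 6 * (r + 1) ^ 3 := add_le_add (hb1.trans hb4) hb3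
      _ = _ := by ring
  have hcd : logDeriv f =ᶠ[codiscreteWithin (sphere 0 |r|)] h := by
    refine hdec.filter_mono (codiscreteWithin_mono fun z hz => ?_)
    have : ‖z‖ = r := by simpa [abs_of_pos (by linarith : 0 < r)] using hz
    simpa [this] using hRr
  have hint : CircleIntegrable (fun z => log⁺ ‖h z‖) 0 r := by
    refine CircleIntegrable.congr_codiscreteWithin (f₁ := fun z => log⁺ ‖logDeriv f z‖) ?_ ?_
    · filter_upwards [hcd] with z hz
      rw [hz]
    · have : Meromorphic (logDeriv f) := hf.deriv.div hf
      exact this.meromorphicOn.circleIntegrable_posLog_norm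
  rw [proximity_congr_codiscreteWithin hcd (by linarith), proximity_top]
  refine circleAverage_mono_on_of_le_circle hint fun z hz => ?_
  refine (posLog_le_posLog (norm_nonneg _) (hbound z hz)).trans_eq ?_
  have hρ : 1 ≤ r + 1 := by linarith
  rw [posLog_eq_log, Real.log_mul (by positivity) (by positivity),
    Real.log_mul (by positivity) (by positivity), Real.log_pow, Real.log_pow]
  · push_cast; ring
  · rw [abs_of_pos (by positivity)]
    have h1 : 1 ≤ t ^ 6 := one_le_pow₀ ht1
    have h2 : 1 ≤ (r + 1) ^ 3 := one_le_pow₀ hρ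
    nlinarith [mul_le_mul h1 h2 zero_le_one (by positivity)]

/-! ### Transcendental functions grow faster than the logarithm -/

/-- Any `N` distinct zeros or poles force a contribution of at least `N log r - O(1)` to the
counting functions. -/
lemma finite_support_divisor_of_frequently_le_log {f : ℂ → ℂ} {K : ℝ}
    (h : ∃ᶠ r in atTop, totalCharacteristic f r ≤ K * Real.log r) :
    (divisor f univ).support.Finite := by
  by_contra hinf
  obtain ⟨N, hN⟩ := exists_nat_gt (2 * K)
  obtain ⟨s, hs, hcard⟩ := Set.Infinite.exists_subset_card_eq hinf N
  set E : Function.locallyFinsupp ℂ ℤ := (divisor f univ)⁺ + (divisor f univ)⁻ with hE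
  have hE0 : 0 ≤ E := add_nonneg (posPart_nonneg _) (negPart_nonneg _)
  have hE1 : ∀ u ∈ s, (1 : ℝ) ≤ E u := by
    intro u hu
    rw [hE, Function.locallyFinsuppWithin.coe_add, Pi.add_apply,
      Function.locallyFinsuppWithin.posPart_apply, Function.locallyFinsuppWithin.negPart_apply,
      posPart_add_negPart]
    exact_mod_cast Int.one_le_abs (hs hu)
  obtain ⟨R, hR⟩ : ∃ R : ℝ, ∀ u ∈ s, ‖u‖ ≤ R := by
    obtain ⟨R, hR⟩ := (s.finite_toSet.image (fun u : ℂ => ‖u‖)).bddAbove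
    exact ⟨R, fun u hu => hR (mem_image_of_mem _ hu)⟩
  set R₁ := max R 1 with hR₁
  have hball : ∀ u ∈ s, u ∈ closedBall (0 : ℂ) R₁ := fun u hu => by
    rw [mem_closedBall_zero_iff]; exact (hR u hu).trans (le_max_left R 1)
  have hR₁1 : 1 ≤ R₁ := le_max_right _ _
  -- For `r > R₁ ^ 2` one has `log r - log R₁ > (log r) / 2`, which together with `N > 2 K`
  -- contradicts the growth bound.
  obtain ⟨r, hr, hr1, hr2⟩ := (h.and_eventually
    ((eventually_gt_atTop R₁).and (eventually_gt_atTop (R₁ ^ 2)))).exists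
  have h1 := sum_mul_log_le_logCounting hE0 hR₁1 hr1 hball
  have h2 : (N : ℝ) ≤ ∑ u ∈ s, (E u : ℝ) := by
    rw [← hcard, Finset.card_eq_sum_ones]
    push_cast
    exact Finset.sum_le_sum hE1
  have h3 := logCounting_add_logCounting_le_totalCharacteristic f r
  rw [hE, map_add, Pi.add_apply, ← logCounting_zero, ← logCounting_top] at h1
  have h4 : 2 * Real.log R₁ < Real.log r := by
    have := Real.log_lt_log (by positivity) hr2
    rwa [Real.log_pow] at this
  have h5 := Real.log_nonneg hR₁1
  have h6 : (N : ℝ) * (Real.log r - Real.log R₁) ≤ K * Real.log r := by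
    refine le_trans ?_ (h1.trans (h3.trans hr))
    exact mul_le_mul_of_nonneg_right h2 (by linarith)
  have h7 : (0 : ℝ) ≤ N := Nat.cast_nonneg N
  nlinarith

/-- A meromorphic function with logarithmic growth along a sequence of radii is rational. -/
theorem isRationalFunction_of_frequently_le_log {f : ℂ → ℂ} (hf : Meromorphic f)
    (hf' : ∀ z, meromorphicOrderAt f z ≠ ⊤) {K : ℝ}
    (h : ∃ᶠ r in atTop, totalCharacteristic f r ≤ K * Real.log r) :
    IsRationalFunction f := by
  have hfin := finite_support_divisor_of_frequently_le_log h
  set D := divisor f univ with hD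
  obtain ⟨g, hg, hne, hfg⟩ := (hf.meromorphicOn (s := univ)).extract_zeros_poles
    (fun u => hf' u) hfin
  rw [← hD] at hfg
  have hlog := log_norm_eq_sum_of_factorization hfin hne hfg
  set s := hfin.toFinset with hs
  set N := ∑ u ∈ s, |(D u : ℝ)| with hN
  have hN0 : 0 ≤ N := Finset.sum_nonneg fun _ _ => abs_nonneg _
  obtain ⟨R₀, hR₀⟩ : ∃ R : ℝ, ∀ u ∈ s, ‖u‖ ≤ R := by
    obtain ⟨R, hR⟩ := (s.finite_toSet.image (fun u : ℂ => ‖u‖)).bddAbove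
    exact ⟨R, fun u hu => hR (mem_image_of_mem _ hu)⟩
  have hgd : Differentiable ℂ g := fun z => (hg z (mem_univ z)).differentiableAt
  -- With all zeros and poles removed, the estimate for `g' / g` at a fixed `w` is `O(log R / R)`
  -- along the given radii, so it vanishes in the limit and `g` is constant.
  have hder : ∀ w, deriv g w = 0 := by
    intro w
    have hlim : Tendsto (fun R : ℝ => (8 * K + 16 * N) * (Real.log R / R) +
        16 * N * Real.log 2 * R⁻¹) atTop (𝓝 0) := by
      have h1 : Tendsto (fun R : ℝ => Real.log R / R) atTop (𝓝 0) :=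
        Real.isLittleO_log_id_atTop.tendsto_div_nhds_zero
      simpa using (h1.const_mul (8 * K + 16 * N)).add
        (tendsto_inv_atTop_zero.const_mul (16 * N * Real.log 2))
    have hle : ‖logDeriv g w‖ ≤ 0 := by
      refine ge_of_tendsto_of_frequently hlim ?_
      refine (h.and_eventually (((eventually_ge_atTop R₀).and (eventually_ge_atTop 1)).and
        (eventually_gt_atTop (2 * ‖w‖)))).mono ?_
      rintro R ⟨hTR, ⟨hR0, hR1⟩, hRw⟩
      have hRpos : 0 < R := by linarith
      have hwR : ‖w‖ < R := by linarith [norm_nonneg w]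
      refine (norm_logDeriv_le_of_log_norm_eq hf hR1 (hg.mono (subset_univ _))
        (fun u _ => hne ⟨u, mem_univ u⟩) (D := D) (s := s)
        (fun u hu => by simpa using (hR₀ u hu).trans hR0)
        (hlog.filter_mono (codiscreteWithin_mono (subset_univ _))) (by simpa using hwR)).trans ?_
      have hprox := (proximity_add_proximity_le_totalCharacteristic f hR1).trans hTR
      have h1 := add_nonneg (proximity_nonneg (f := f) (a := ⊤) R)
        (proximity_nonneg (f := f⁻¹) (a := ⊤) R)
      simp only at h1
      rw [← hN, Real.log_mul two_ne_zero hRpos.ne']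
      have hlogR := Real.log_nonneg hR1
      have hlog2 : 0 ≤ Real.log 2 := Real.log_nonneg one_le_two
      have h2 : 2 * R / (R - ‖w‖) ^ 2 ≤ 8 * R⁻¹ := by
        calc 2 * R / (R - ‖w‖) ^ 2 ≤ 2 * R / (R / 2) ^ 2 := by gcongr; linarith
          _ = 8 * R⁻¹ := by field_simp; norm_num
      calc _ ≤ 8 * R⁻¹ * (K * Real.log R + N * (2 * (Real.log 2 + Real.log R))) := by
            gcongr
        _ = _ := by ring
    have h0 : logDeriv g w = 0 := norm_le_zero_iff.1 hle
    rw [logDeriv_apply, div_eq_zero_iff] at h0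
    exact h0.resolve_right (hne ⟨w, mem_univ w⟩)
  have hconst : ∀ z, g z = g 0 := fun z => is_const_of_deriv_eq_zero hgd hder z 0
  -- Zeros go to the numerator and poles to the denominator: for each `u` one of the two `toNat`
  -- exponents is `0`.
  refine ⟨Polynomial.C (g 0) * ∏ u ∈ s, (Polynomial.X - Polynomial.C u) ^ (D u).toNat,
    ∏ u ∈ s, (Polynomial.X - Polynomial.C u) ^ (-D u).toNat, ?_, ?_⟩
  · exact Finset.prod_ne_zero_iff.2 fun u _ => pow_ne_zero _ (Polynomial.X_sub_C_ne_zero u)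
  · filter_upwards [hfg] with z hz
    rw [hz, finprod_eq_prod_of_mulSupport_subset (s := s), Pi.smul_apply', Finset.prod_apply,
      hconst z]
    · simp only [Pi.pow_apply, smul_eq_mul, Polynomial.eval_mul, Polynomial.eval_C,
        Polynomial.eval_prod, Polynomial.eval_pow, Polynomial.eval_sub, Polynomial.eval_X]
      rw [mul_div_assoc, ← Finset.prod_div_distrib, mul_comm]
      congr 1
      refine Finset.prod_congr rfl fun u _ => ?_
      rcases le_total 0 (D u) with h | h
      · rw [Int.toNat_of_nonpos (neg_nonpos.2 h), pow_zero, div_one, ← zpow_natCast,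
          Int.toNat_of_nonneg h]
      · rw [Int.toNat_of_nonpos h, pow_zero, ← zpow_natCast, Int.toNat_of_nonneg (by omega),
          zpow_neg, one_div, inv_inv]
    · intro u hu
      rw [hs, hfin.coe_toFinset]
      contrapose! hu
      have : D u = 0 := by simpa using hu
      simp [this]

/-! ### Identity theorem and the growth of the characteristic -/

lemma eq_zero_of_exists_meromorphicOrderAt_eq_top {f : ℂ → ℂ} (hf : Meromorphic f) {z : ℂ}
    (hz : meromorphicOrderAt f z = ⊤) : f =ᶠ[codiscrete ℂ] 0 := by
  have hall : ∀ w, meromorphicOrderAt f w = ⊤ := by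
    intro w
    by_contra hw
    exact hf.meromorphicOn.meromorphicOrderAt_ne_top_of_isPreconnected isPreconnected_univ
      (mem_univ w) (mem_univ z) hw hz
  change _ ∈ codiscreteWithin univ
  rw [mem_codiscreteWithin_iff_forall_mem_nhdsNE]
  intro x _
  filter_upwards [meromorphicOrderAt_eq_top_iff.1 (hall x)] with y hy
  exact Or.inl hy

lemma meromorphicOrderAt_ne_top_of_not_eq_zero {f : ℂ → ℂ} (hf : Meromorphic f)
    (h : ¬ f =ᶠ[codiscrete ℂ] 0) (z : ℂ) : meromorphicOrderAt f z ≠ ⊤ :=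
  fun hz => h (eq_zero_of_exists_meromorphicOrderAt_eq_top hf hz)

lemma IsTranscendentalMeromorphic.meromorphicOrderAt_ne_top {f : ℂ → ℂ}
    (hf : IsTranscendentalMeromorphic f) (z : ℂ) : meromorphicOrderAt f z ≠ ⊤ := by
  refine meromorphicOrderAt_ne_top_of_not_eq_zero hf.1 (fun h => hf.2 ⟨0, 1, one_ne_zero, ?_⟩) z
  filter_upwards [h] with z hz
  simp [hz]

/-- The characteristic function of a transcendental meromorphic function grows faster than the
logarithm. -/
theorem IsTranscendentalMeromorphic.isLittleO_log_characteristic {f : ℂ → ℂ}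
    (hf : IsTranscendentalMeromorphic f) :
    Real.log =o[atTop] (characteristic f ⊤) := by
  rw [Asymptotics.isLittleO_iff]
  intro c hc
  by_contra hcon
  rw [not_eventually] at hcon
  -- By Jensen's formula, `T(r, 1/f)` differs from `T(r, f)` by this constant at most, so a
  -- logarithmic bound for `T(r, f)` passes to `totalCharacteristic`.
  set A := |Real.log ‖meromorphicTrailingCoeffAt f 0‖| with hA
  refine hf.2 (isRationalFunction_of_frequently_le_log hf.1 hf.meromorphicOrderAt_ne_top
    (K := 2 * c⁻¹ + (1 + A)) ?_)
  refine (hcon.and_eventually (eventually_ge_atTop (Real.exp 1))).mono ?_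
  rintro r ⟨h1, h2⟩
  have hr1 : 1 ≤ r := le_trans (Real.one_le_exp zero_le_one) h2
  have hlog : 1 ≤ Real.log r := by
    rw [Real.le_log_iff_exp_le (by linarith)]; exact h2
  rw [not_le, Real.norm_of_nonneg (characteristic_nonneg hr1), Real.norm_of_nonneg (by linarith)]
    at h1
  have h3 : characteristic f ⊤ r ≤ c⁻¹ * Real.log r := by
    rw [inv_mul_eq_div, le_div_iff₀ hc, mul_comm]
    exact h1.le
  have h4 := characteristic_sub_characteristic_inv_of_ne_zero hf.1 (R := r) (by linarith)
  have h5 : -A ≤ Real.log ‖meromorphicTrailingCoeffAt f 0‖ := neg_abs_le _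
  have h6 : 0 ≤ A := abs_nonneg _
  unfold totalCharacteristic
  nlinarith

/-! ### Derivatives of meromorphic functions -/

lemma eventuallyEq_nhdsNE_of_codiscrete {f g : ℂ → ℂ} (h : f =ᶠ[codiscrete ℂ] g) (z : ℂ) :
    f =ᶠ[𝓝[≠] z] g := by
  have h1 : {x | f x = g x} ∈ codiscreteWithin univ := h
  filter_upwards [mem_codiscreteWithin_iff_forall_mem_nhdsNE.1 h1 z (mem_univ z)] with x hx
  simpa using hx

lemma eventually_codiscrete_ne_zero {f : ℂ → ℂ} (hf : Meromorphic f)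
    (hf' : ∀ z, meromorphicOrderAt f z ≠ ⊤) : ∀ᶠ z in codiscrete ℂ, f z ≠ 0 :=
  (hf.meromorphicOn (s := univ)).eventually_codiscreteWithin_apply_ne_zero fun z _ => hf' z

lemma eventually_codiscrete_differentiableAt {f : ℂ → ℂ} (hf : Meromorphic f) :
    ∀ᶠ z in codiscrete ℂ, DifferentiableAt ℂ f z := by
  have h : ∀ᶠ z in codiscrete ℂ, AnalyticAt ℂ f z :=
    (hf.meromorphicOn (s := univ)).analyticAt_mem_codiscreteWithin
  exact h.mono fun z hz => hz.differentiableAt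

lemma exists_eq_const_of_meromorphicOrderAt_deriv_eq_top {f : ℂ → ℂ} (hf : Meromorphic f) {z : ℂ}
    (hz : meromorphicOrderAt (deriv f) z = ⊤) : ∃ c, f =ᶠ[codiscrete ℂ] fun _ => c := by
  -- After subtracting the value at `z` (or nothing, if `f` has nonzero order there), the order is
  -- nonzero. If it were a finite `n`, the derivative would have the finite order `n - 1`.
  obtain ⟨c, hc⟩ : ∃ c : ℂ, meromorphicOrderAt (fun w => f w - c) z ≠ 0 := by
    rcases eq_or_ne (meromorphicOrderAt f z) 0 with h | h
    · obtain ⟨c, -, hc⟩ := (tendsto_ne_zero_iff_meromorphicOrderAt_eq_zero (hf z)).2 h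
      refine ⟨c, ne_of_gt ((tendsto_zero_iff_meromorphicOrderAt_pos
        ((hf z).fun_sub (MeromorphicAt.const c z))).1 ?_)⟩
      simpa using hc.sub_const c
    · exact ⟨0, by simpa using h⟩
  refine ⟨c, ?_⟩
  have htop : meromorphicOrderAt (fun w => f w - c) z = ⊤ := by
    by_contra hne
    lift meromorphicOrderAt (fun w => f w - c) z to ℤ using hne with n hn
    have := meromorphicOrderAt_deriv_eq_sub_one (n := n)
      (by exact_mod_cast hc) hn.symm
    rw [funext (fun w => deriv_sub_const (f := f) (x := w) c), hz] at this
    exact absurd this WithTop.top_ne_coe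
  have := eq_zero_of_exists_meromorphicOrderAt_eq_top (hf.sub (Meromorphic.const c)) htop
  filter_upwards [this] with w hw
  exact sub_eq_zero.1 hw

lemma Polynomial.exists_derivative_eq (p : Polynomial ℂ) :
    ∃ P : Polynomial ℂ, Polynomial.derivative P = p := by
  induction p using Polynomial.induction_on' with
  | add p q hp hq =>
    obtain ⟨P, rfl⟩ := hp
    obtain ⟨Q, rfl⟩ := hq
    exact ⟨P + Q, by simp⟩
  | monomial n a =>
    refine ⟨Polynomial.monomial (n + 1) (a / (n + 1)), ?_⟩
    rw [Polynomial.derivative_monomial, Nat.add_sub_cancel]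
    congr 1
    have : (n : ℂ) + 1 ≠ 0 := Nat.cast_add_one_ne_zero n
    push_cast
    field_simp

/-- Integrating back `n` times from zero yields a polynomial; hence no derivative of a
transcendental function vanishes identically. -/
lemma exists_polynomial_of_meromorphicOrderAt_iteratedDeriv_eq_top {f : ℂ → ℂ} {n : ℕ}
    (hf : Meromorphic f) {z : ℂ} (hz : meromorphicOrderAt (iteratedDeriv n f) z = ⊤) :
    ∃ p : Polynomial ℂ, f =ᶠ[codiscrete ℂ] fun w => p.eval w := by
  induction n generalizing f with
  | zero =>
    refine ⟨0, ?_⟩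
    rw [iteratedDeriv_zero] at hz
    filter_upwards [eq_zero_of_exists_meromorphicOrderAt_eq_top hf hz] with w hw
    simpa using hw
  | succ n ih =>
    rw [iteratedDeriv_succ'] at hz
    obtain ⟨p, hp⟩ := ih hf.deriv hz
    obtain ⟨P, rfl⟩ := p.exists_derivative_eq
    have hP : Meromorphic (fun w => P.eval w) := fun w => by
      exact (P.differentiable.analyticAt w).meromorphicAt
    obtain ⟨c, hc⟩ := exists_eq_const_of_meromorphicOrderAt_deriv_eq_top (z := z) (hf.fun_sub hP) (by
      rw [meromorphicOrderAt_eq_top_iff]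
      refine eventuallyEq_nhdsNE_of_codiscrete (f := deriv fun w => f w - P.eval w) (g := 0) ?_ z
      filter_upwards [hp, eventually_codiscrete_differentiableAt hf] with w hw hw'
      rw [deriv_fun_sub hw' P.differentiableAt, hw, P.deriv]
      simp)
    refine ⟨P + Polynomial.C c, ?_⟩
    filter_upwards [hc] with w hw
    rw [Polynomial.eval_add, Polynomial.eval_C, ← hw]
    ring

lemma IsTranscendentalMeromorphic.meromorphicOrderAt_iteratedDeriv_ne_top {f : ℂ → ℂ}
    (hf : IsTranscendentalMeromorphic f) (n : ℕ) (z : ℂ) :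
    meromorphicOrderAt (iteratedDeriv n f) z ≠ ⊤ := fun hz => by
  obtain ⟨p, hp⟩ := exists_polynomial_of_meromorphicOrderAt_iteratedDeriv_eq_top hf.1 hz
  exact hf.2 ⟨p, 1, one_ne_zero, by simpa using hp⟩

lemma Meromorphic.iteratedDeriv {f : ℂ → ℂ} (hf : Meromorphic f) (n : ℕ) :
    Meromorphic (iteratedDeriv n f) := by
  rw [iteratedDeriv_eq_iterate]
  exact hf.iterated_deriv

lemma meromorphicOrderAt_deriv_nonneg {f : ℂ → ℂ} {z : ℂ} (hf : MeromorphicAt f z)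
    (h : 0 ≤ meromorphicOrderAt f z) : 0 ≤ meromorphicOrderAt (deriv f) z := by
  rcases eq_or_ne (meromorphicOrderAt f z) ⊤ with htop | htop
  · have h1 : f =ᶠ[𝓝[≠] z] fun _ => (0 : ℂ) := meromorphicOrderAt_eq_top_iff.1 htop
    rw [meromorphicOrderAt_congr h1.nhdsNE_deriv]
    simp only [deriv_const']
    exact (analyticAt_const (𝕜 := ℂ)).meromorphicOrderAt_nonneg
  · lift meromorphicOrderAt f z to ℤ using htop with n hn
    obtain ⟨g, h₁g, -, h₃g⟩ := (meromorphicOrderAt_eq_int_iff hf).1 hn.symm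
    have hn0 : 0 ≤ n := by exact_mod_cast h
    have hana : AnalyticAt ℂ (fun w => (w - z) ^ n • g w) z :=
      (AnalyticAt.fun_zpow_nonneg (f := fun w => w - z) (by fun_prop) hn0).smul h₁g
    rw [meromorphicOrderAt_congr (EventuallyEq.nhdsNE_deriv h₃g)]
    exact hana.deriv.meromorphicOrderAt_nonneg

lemma meromorphicOrderAt_iteratedDeriv_nonneg {f : ℂ → ℂ} {z : ℂ} (hf : Meromorphic f)
    (h : 0 ≤ meromorphicOrderAt f z) (n : ℕ) : 0 ≤ meromorphicOrderAt (iteratedDeriv n f) z := by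
  induction n with
  | zero => rwa [iteratedDeriv_zero]
  | succ n ih =>
    rw [iteratedDeriv_succ]
    exact meromorphicOrderAt_deriv_nonneg (hf.iteratedDeriv n z) ih

/-- A pole of order `m ≥ 1` becomes one of order `m + 1 ≤ 2m`, and no new poles appear. -/
lemma negPart_divisor_deriv_le {f : ℂ → ℂ} (hf : Meromorphic f)
    (hf' : ∀ z, meromorphicOrderAt f z ≠ ⊤) :
    (divisor (deriv f) univ)⁻ ≤ 2 • (divisor f univ)⁻ := by
  intro z
  rw [Function.locallyFinsuppWithin.coe_nsmul, Pi.smul_apply,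
    Function.locallyFinsuppWithin.negPart_apply, Function.locallyFinsuppWithin.negPart_apply,
    divisor_apply hf.deriv.meromorphicOn (mem_univ z), divisor_apply hf.meromorphicOn (mem_univ z)]
  rcases le_or_gt 0 (meromorphicOrderAt f z) with h | h
  · have h1 : 0 ≤ (meromorphicOrderAt (deriv f) z).untop₀ :=
      WithTop.untop₀_nonneg.2 (meromorphicOrderAt_deriv_nonneg (hf z) h)
    rw [negPart_of_nonneg h1]
    positivity
  · have h2 := hf' z
    lift meromorphicOrderAt f z to ℤ using h2 with n hn
    have hn0 : n < 0 := by exact_mod_cast h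
    rw [meromorphicOrderAt_deriv_eq_sub_one (n := n) (by exact_mod_cast hn0.ne) hn.symm]
    simp only [WithTop.untop₀_coe]
    rw [negPart_of_nonpos (by omega), negPart_of_nonpos (by omega)]
    simp; omega

lemma logCounting_deriv_le {f : ℂ → ℂ} (hf : Meromorphic f)
    (hf' : ∀ z, meromorphicOrderAt f z ≠ ⊤) {r : ℝ} (hr : 1 ≤ r) :
    logCounting (deriv f) ⊤ r ≤ 2 * logCounting f ⊤ r := by
  rw [logCounting_top, logCounting_top]
  refine (Function.locallyFinsuppWithin.logCounting_le (negPart_divisor_deriv_le hf hf') hr).trans ?_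
  rw [map_nsmul]
  simp

lemma proximity_deriv_le {f : ℂ → ℂ} (hf : Meromorphic f)
    (hf' : ∀ z, meromorphicOrderAt f z ≠ ⊤) {r : ℝ} (hr : r ≠ 0) :
    proximity (deriv f) ⊤ r ≤ proximity f ⊤ r + proximity (logDeriv f) ⊤ r := by
  have h : deriv f =ᶠ[codiscrete ℂ] f * logDeriv f := by
    filter_upwards [eventually_codiscrete_ne_zero hf hf'] with z hz
    rw [Pi.mul_apply, logDeriv_apply, mul_div_cancel₀ _ hz]
  rw [proximity_congr_codiscrete h hr]
  exact proximity_mul_top_le hf hf.logDeriv r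

/-! ### Order of growth relative to a comparison function -/

section Growth

open Asymptotics

variable {T u v : ℝ → ℝ} {f g : ℂ → ℂ}

lemma isLittleO_of_nonneg_of_le {l : Filter ℝ} (h0 : ∀ᶠ r in l, 0 ≤ u r)
    (h : ∀ᶠ r in l, u r ≤ v r) (hv : v =o[l] T) : u =o[l] T := by
  refine IsBigO.trans_isLittleO (IsBigO.of_bound 1 ?_) hv
  filter_upwards [h0, h] with r h1 h2
  rw [one_mul, Real.norm_of_nonneg h1, Real.norm_of_nonneg (h1.trans h2)]
  exact h2

lemma isBigO_of_nonneg_of_le {l : Filter ℝ} (h0 : ∀ᶠ r in l, 0 ≤ u r)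
    (h : ∀ᶠ r in l, u r ≤ v r) (hv : v =O[l] T) : u =O[l] T := by
  refine IsBigO.trans (IsBigO.of_bound 1 ?_) hv
  filter_upwards [h0, h] with r h1 h2
  rw [one_mul, Real.norm_of_nonneg h1, Real.norm_of_nonneg (h1.trans h2)]
  exact h2

lemma eventually_atTopOffFinite_ge (a : ℝ) : ∀ᶠ r in atTopOffFinite, a ≤ r :=
  atTopOffFinite_le_atTop (eventually_ge_atTop a)

lemma const_isLittleO (hlog : Real.log =o[atTopOffFinite] T) (c : ℝ) :
    (fun _ => c) =o[atTopOffFinite] T :=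
  (isLittleO_const_log_atTop.mono atTopOffFinite_le_atTop).trans hlog

/-- `T` dominates `log`, so it tends to infinity in absolute value, and `log (C |T|) = o(T)`. -/
lemma log_comp_isLittleO (hlog : Real.log =o[atTopOffFinite] T)
    (h1 : ∀ᶠ r in atTopOffFinite, 1 ≤ u r) (hu : u =O[atTopOffFinite] T) :
    (fun r => Real.log (u r)) =o[atTopOffFinite] T := by
  obtain ⟨C, hC, hb⟩ := hu.exists_pos
  have hT : Tendsto (fun r => C * ‖T r‖) atTopOffFinite atTop := by
    refine Tendsto.const_mul_atTop hC ?_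
    refine tendsto_atTop_mono' _ ?_ (Real.tendsto_log_atTop.mono_left atTopOffFinite_le_atTop)
    filter_upwards [hlog.bound one_pos] with r hr
    rw [one_mul] at hr
    exact (Real.le_norm_self _).trans hr
  have h2 : (fun r => Real.log (C * ‖T r‖)) =o[atTopOffFinite] fun r => C * ‖T r‖ :=
    Real.isLittleO_log_id_atTop.comp_tendsto hT
  refine isLittleO_of_nonneg_of_le (h1.mono fun r hr => Real.log_nonneg hr) ?_
    (h2.trans_isBigO ((isBigO_refl T _).norm_left.const_mul_left C))
  filter_upwards [h1, hb.bound] with r hr hr'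
  refine Real.log_le_log (by linarith) ?_
  exact (Real.le_norm_self _).trans hr'

lemma characteristic_inv_sub_isLittleO (hlog : Real.log =o[atTopOffFinite] T)
    (hf : Meromorphic f) :
    (fun r => characteristic f ⊤ r - characteristic f⁻¹ ⊤ r) =o[atTopOffFinite] T := by
  have h := (isBigO_characteristic_sub_characteristic_inv hf).mono atTopOffFinite_le_atTop
  exact h.trans_isLittleO (const_isLittleO hlog 1)

lemma characteristic_inv_isBigO (hlog : Real.log =o[atTopOffFinite] T) (hf : Meromorphic f)
    (h : characteristic f ⊤ =O[atTopOffFinite] T) :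
    characteristic f⁻¹ ⊤ =O[atTopOffFinite] T := by
  refine (h.sub (characteristic_inv_sub_isLittleO hlog hf).isBigO).congr_left fun r => ?_
  simp

lemma characteristic_inv_isLittleO (hlog : Real.log =o[atTopOffFinite] T) (hf : Meromorphic f)
    (h : characteristic f ⊤ =o[atTopOffFinite] T) :
    characteristic f⁻¹ ⊤ =o[atTopOffFinite] T := by
  refine (h.sub (characteristic_inv_sub_isLittleO hlog hf)).congr_left fun r => ?_
  simp

lemma proximity_isLittleO (h : characteristic f ⊤ =o[atTopOffFinite] T) :
    proximity f ⊤ =o[atTopOffFinite] T := by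
  refine isLittleO_of_nonneg_of_le (Eventually.of_forall proximity_nonneg) ?_ h
  filter_upwards [eventually_atTopOffFinite_ge 1] with r hr
  exact le_add_of_nonneg_right (logCounting_nonneg hr)

lemma logCounting_isLittleO (h : characteristic f ⊤ =o[atTopOffFinite] T) :
    logCounting f ⊤ =o[atTopOffFinite] T := by
  refine isLittleO_of_nonneg_of_le ?_ ?_ h
  · filter_upwards [eventually_atTopOffFinite_ge 1] with r hr using logCounting_nonneg hr
  · exact Eventually.of_forall fun r => le_add_of_nonneg_left (proximity_nonneg r)

/-- **Lemma on the logarithmic derivative**, in asymptotic form. -/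
theorem proximity_logDeriv_isLittleO (hlog : Real.log =o[atTopOffFinite] T)
    (hf : Meromorphic f) (hf' : ∀ z, meromorphicOrderAt f z ≠ ⊤)
    (h : characteristic f ⊤ =O[atTopOffFinite] T) :
    proximity (logDeriv f) ⊤ =o[atTopOffFinite] T := by
  have h1 : totalCharacteristic f =O[atTopOffFinite] T :=
    ((const_isLittleO hlog 1).isBigO.add h).add (characteristic_inv_isBigO hlog hf h)
  have h2 := log_comp_isLittleO hlog
    ((eventually_atTopOffFinite_ge 1).mono fun r hr => one_le_totalCharacteristic f hr) h1
  have h3 : (fun r => Real.log (r + 1)) =o[atTopOffFinite] T := by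
    refine isLittleO_of_nonneg_of_le (v := fun r => 2 * Real.log r) ?_ ?_
      (hlog.const_mul_left 2)
    · filter_upwards [eventually_atTopOffFinite_ge 0] with r hr
      exact Real.log_nonneg (by linarith)
    -- `r + 1 ≤ r ^ 2` for `r ≥ 2`.
    · filter_upwards [eventually_atTopOffFinite_ge 2] with r hr
      rw [← Nat.cast_two, ← Real.log_pow]
      exact Real.log_le_log (by linarith) (by nlinarith)
  refine isLittleO_of_nonneg_of_le (Eventually.of_forall proximity_nonneg)
    (eventually_proximity_logDeriv_le hf hf')
    (((const_isLittleO hlog _).add (h2.const_mul_left 6)).add (h3.const_mul_left 3))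

lemma characteristic_deriv_isBigO (hlog : Real.log =o[atTopOffFinite] T)
    (hf : Meromorphic f) (hf' : ∀ z, meromorphicOrderAt f z ≠ ⊤)
    (h : characteristic f ⊤ =O[atTopOffFinite] T) :
    characteristic (deriv f) ⊤ =O[atTopOffFinite] T := by
  refine isBigO_of_nonneg_of_le
    (v := fun r => 2 * characteristic f ⊤ r + proximity (logDeriv f) ⊤ r) ?_ ?_
    ((h.const_mul_left 2).add (proximity_logDeriv_isLittleO hlog hf hf' h).isBigO)
  · filter_upwards [eventually_atTopOffFinite_ge 1] with r hr using characteristic_nonneg hr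
  · filter_upwards [eventually_atTopOffFinite_ge 1] with r hr
    have h1 := logCounting_deriv_le hf hf' hr
    have h2 := proximity_deriv_le hf hf' (r := r) (by linarith)
    have h3 : 0 ≤ proximity f ⊤ r := proximity_nonneg r
    simp only [characteristic, Pi.add_apply]
    linarith

lemma characteristic_iteratedDeriv_isBigO (hlog : Real.log =o[atTopOffFinite] T)
    (hf : Meromorphic f) (hf' : ∀ n z, meromorphicOrderAt (iteratedDeriv n f) z ≠ ⊤)
    (h : characteristic f ⊤ =O[atTopOffFinite] T) (n : ℕ) :
    characteristic (iteratedDeriv n f) ⊤ =O[atTopOffFinite] T := by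
  induction n with
  | zero => rwa [iteratedDeriv_zero]
  | succ n ih =>
    rw [iteratedDeriv_succ]
    exact characteristic_deriv_isBigO hlog (hf.iteratedDeriv n) (hf' n) ih

lemma proximity_mul_isLittleO (hf : Meromorphic f) (hg : Meromorphic g)
    (h1 : proximity f ⊤ =o[atTopOffFinite] T) (h2 : proximity g ⊤ =o[atTopOffFinite] T) :
    proximity (f * g) ⊤ =o[atTopOffFinite] T :=
  isLittleO_of_nonneg_of_le (Eventually.of_forall proximity_nonneg)
    (Eventually.of_forall (proximity_mul_top_le hf hg)) (h1.add h2)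

/-- Telescoping: `f^{(n+1)} / f` is the logarithmic derivative of `f^{(n)}` times `f^{(n)} / f`. -/
lemma proximity_iteratedDeriv_div_isLittleO (hlog : Real.log =o[atTopOffFinite] T)
    (hf : Meromorphic f) (hf' : ∀ n z, meromorphicOrderAt (iteratedDeriv n f) z ≠ ⊤)
    (h : characteristic f ⊤ =O[atTopOffFinite] T) (n : ℕ) :
    proximity (iteratedDeriv n f / f) ⊤ =o[atTopOffFinite] T := by
  have hf0 : ∀ᶠ z in codiscrete ℂ, f z ≠ 0 :=
    eventually_codiscrete_ne_zero hf (by simpa using hf' 0)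
  induction n with
  | zero =>
    rw [iteratedDeriv_zero]
    refine (const_isLittleO hlog 0).congr' ?_ EventuallyEq.rfl
    filter_upwards [eventually_atTopOffFinite_ge 1] with r hr
    have h1 : f / f =ᶠ[codiscrete ℂ] fun _ => 1 := by
      filter_upwards [hf0] with z hz
      exact div_self hz
    rw [proximity_congr_codiscrete h1 (by linarith), proximity_const]
    simp
  | succ n ih =>
    have h1 := proximity_mul_isLittleO (hf.iteratedDeriv n).logDeriv ((hf.iteratedDeriv n).div hf)
      (proximity_logDeriv_isLittleO hlog (hf.iteratedDeriv n) (hf' n)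
        (characteristic_iteratedDeriv_isBigO hlog hf hf' h n)) ih
    refine h1.congr' ?_ EventuallyEq.rfl
    filter_upwards [eventually_atTopOffFinite_ge 1] with r hr
    refine proximity_congr_codiscrete ?_ (by linarith)
    filter_upwards [eventually_codiscrete_ne_zero (hf.iteratedDeriv n) (hf' n)] with z hz
    rw [Pi.mul_apply, logDeriv_apply, Pi.div_apply, Pi.div_apply, iteratedDeriv_succ]
    field_simp

lemma proximity_prod_isLittleO (hlog : Real.log =o[atTopOffFinite] T) {ι : Type*} (s : Finset ι)
    {F : ι → ℂ → ℂ} (hF : ∀ i, Meromorphic (F i))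
    (h : ∀ i, proximity (F i) ⊤ =o[atTopOffFinite] T) (q : ι → ℕ) :
    proximity (∏ i ∈ s, F i ^ q i) ⊤ =o[atTopOffFinite] T := by
  classical
  induction s using Finset.induction_on with
  | empty =>
    refine (const_isLittleO hlog 0).congr_left fun r => ?_
    have : (∏ i ∈ (∅ : Finset ι), F i ^ q i) = fun _ : ℂ => (1 : ℂ) := by simp; rfl
    rw [this, proximity_const]
    simp
  | insert i s hi ih =>
    rw [Finset.prod_insert hi]
    refine proximity_mul_isLittleO (hF i).pow (Meromorphic.prod fun j _ => (hF j).pow) ?_ ih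
    rw [proximity_pow_top]
    refine ((h i).const_mul_left (q i : ℝ)).congr_left fun r => ?_
    simp

lemma meromorphicOrderAt_prod_pow_ne_top {ι : Type*} (s : Finset ι)
    {F : ι → ℂ → ℂ} (hF : ∀ i, Meromorphic (F i)) (hF' : ∀ i z, meromorphicOrderAt (F i) z ≠ ⊤)
    (q : ι → ℕ) (z : ℂ) : meromorphicOrderAt (∏ i ∈ s, F i ^ q i) z ≠ ⊤ := by
  rw [meromorphicOrderAt_prod fun i _ => (hF i z).pow (q i)]
  rw [Ne, WithTop.sum_eq_top]
  rintro ⟨i, -, hi⟩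
  have h1 := hF' i z
  rw [meromorphicOrderAt_pow (hF i z)] at hi
  lift meromorphicOrderAt (F i) z to ℤ using h1 with n hn
  exact absurd hi (by exact_mod_cast WithTop.coe_ne_top (a := (q i : ℤ) * n))

lemma characteristic_mul_isBigO (hf : Meromorphic f) (hf' : ∀ z, meromorphicOrderAt f z ≠ ⊤)
    (hg : Meromorphic g) (hg' : ∀ z, meromorphicOrderAt g z ≠ ⊤)
    (h1 : characteristic f ⊤ =O[atTopOffFinite] T) (h2 : characteristic g ⊤ =O[atTopOffFinite] T) :
    characteristic (f * g) ⊤ =O[atTopOffFinite] T := by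
  refine isBigO_of_nonneg_of_le ?_ ?_ (h1.add h2)
  · filter_upwards [eventually_atTopOffFinite_ge 1] with r hr using characteristic_nonneg hr
  · filter_upwards [eventually_atTopOffFinite_ge 1] with r hr
    exact characteristic_mul_top_le hr hf hf' hg hg'

lemma characteristic_prod_isBigO (hlog : Real.log =o[atTopOffFinite] T) {ι : Type*} (s : Finset ι)
    {F : ι → ℂ → ℂ} (hF : ∀ i, Meromorphic (F i)) (hF' : ∀ i z, meromorphicOrderAt (F i) z ≠ ⊤)
    (h : ∀ i, characteristic (F i) ⊤ =O[atTopOffFinite] T) (q : ι → ℕ) :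
    characteristic (∏ i ∈ s, F i ^ q i) ⊤ =O[atTopOffFinite] T := by
  classical
  induction s using Finset.induction_on with
  | empty =>
    refine (const_isLittleO hlog 0).isBigO.congr_left fun r => ?_
    have : (∏ i ∈ (∅ : Finset ι), F i ^ q i) = fun _ : ℂ => (1 : ℂ) := by simp; rfl
    rw [this]
    simp [characteristic, proximity_const]
  | insert i s hi ih =>
    rw [Finset.prod_insert hi]
    refine characteristic_mul_isBigO (hF i).pow ?_ (Meromorphic.prod fun j _ => (hF j).pow)
      (meromorphicOrderAt_prod_pow_ne_top s hF hF' q) ?_ ih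
    · simpa using meromorphicOrderAt_prod_pow_ne_top {i} hF hF' q
    rw [characteristic_pow_top (hF i)]
    refine ((h i).const_mul_left (q i : ℝ)).congr_left fun r => ?_
    simp

end Growth

/-! ### Small functions -/

section SmallFunction

open Asymptotics

variable {b f : ℂ → ℂ}

lemma IsTranscendentalMeromorphic.log_isLittleO (hf : IsTranscendentalMeromorphic f) :
    Real.log =o[atTopOffFinite] characteristic f ⊤ :=
  hf.isLittleO_log_characteristic.mono atTopOffFinite_le_atTop

lemma IsSmallFunction.characteristic_isLittleO (hb : IsSmallFunction b f) :
    characteristic b ⊤ =o[atTopOffFinite] characteristic f ⊤ := by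
  obtain ⟨E, -, hE, h⟩ := hb.2.2
  exact h.mono (atTopOffFinite_le_of_volume_lt_top hE)

lemma IsSmallFunction.meromorphicOrderAt_ne_top (hb : IsSmallFunction b f) (z : ℂ) :
    meromorphicOrderAt b z ≠ ⊤ :=
  meromorphicOrderAt_ne_top_of_not_eq_zero hb.1 hb.2.1 z

/-- Poles are counted by `T(r, b)` and zeros by `T(r, 1/b) = T(r, b) + O(1)`. -/
lemma IsSmallFunction.logCounting_abs_divisor_isLittleO (hf : IsTranscendentalMeromorphic f)
    (hb : IsSmallFunction b f) :
    ((divisor b univ)⁺ + (divisor b univ)⁻).logCounting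
      =o[atTopOffFinite] characteristic f ⊤ := by
  rw [map_add, ← logCounting_zero, ← logCounting_top, ← logCounting_inv]
  have h := hb.characteristic_isLittleO
  exact (logCounting_isLittleO (characteristic_inv_isLittleO hf.log_isLittleO hb.1 h)).add
    (logCounting_isLittleO h)

end SmallFunction

/-! ### Orders of `G' / (G - 1)` -/

/-- Poles of `G` are poles of `G - 1`, giving simple poles of the logarithmic derivative. At a zero
of `G` the denominator is a unit, so the order is that of `G'`. Where `G` has order zero, a pole can
only come from a zero of `G - 1`. -/
lemma meromorphicOrderAt_logDeriv_sub_one {G : ℂ → ℂ} (hG : Meromorphic G) {z : ℂ} {g : ℤ}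
    (hg : meromorphicOrderAt G z = g) (hG1 : meromorphicOrderAt (fun w => G w - 1) z ≠ ⊤)
    (hdG : meromorphicOrderAt (deriv G) z ≠ ⊤) :
    ∃ h : ℤ, meromorphicOrderAt (logDeriv fun w => G w - 1) z = h ∧ (g < 0 → h = -1) ∧
      (0 < g → h = g - 1) ∧ (g = 0 → 0 ≤ h ∨
        h = -1 ∧ ∃ e : ℤ, 1 ≤ e ∧ meromorphicOrderAt (fun w => G w - 1) z = e) := by
  set K : ℂ → ℂ := fun w => G w - 1 with hK
  have hKm : Meromorphic K := hG.fun_sub (Meromorphic.const 1)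
  have hKadd : K = G + fun _ => -1 := by ext w; simp [hK, sub_eq_add_neg]
  have hconst : meromorphicOrderAt (fun _ : ℂ => (-1 : ℂ)) z = 0 := by
    simp [meromorphicOrderAt_const]
  have hdK : deriv K = deriv G := funext fun w => deriv_sub_const (f := G) (x := w) 1
  have hH : meromorphicOrderAt (logDeriv K) z ≠ ⊤ := by
    intro h
    rw [logDeriv, hdK, meromorphicOrderAt_div hG.deriv.meromorphicAt hKm.meromorphicAt] at h
    lift meromorphicOrderAt (deriv G) z to ℤ using hdG with x
    lift meromorphicOrderAt K z to ℤ using hG1 with y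
    exact WithTop.coe_ne_top (a := x - y) (by exact_mod_cast h)
  have hmero := hKm.meromorphicAt (x := z)
  lift meromorphicOrderAt (logDeriv K) z to ℤ using hH with h hh
  refine ⟨h, rfl, fun hneg => ?_, fun hpos => ?_, fun hzero => ?_⟩
  · have h1 : meromorphicOrderAt K z = g := by
      rw [hKadd, meromorphicOrderAt_add_eq_left_of_lt (MeromorphicAt.const _ _), hg]
      rw [hg, hconst]; exact_mod_cast hneg
    rw [meromorphicOrderAt_logDeriv_eq_neg_one hmero (by rw [h1]; exact_mod_cast hneg.ne) hG1]
      at hh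
    exact WithTop.coe_injective hh
  · have h1 : meromorphicOrderAt K z = 0 := by
      rw [hKadd, meromorphicOrderAt_add_eq_right_of_lt (hG z), hconst]
      rw [hg, hconst]; exact_mod_cast hpos
    rw [logDeriv, hdK, meromorphicOrderAt_div hG.deriv.meromorphicAt hmero, h1,
      meromorphicOrderAt_deriv_eq_sub_one (n := g) (by exact_mod_cast hpos.ne') hg, sub_zero] at hh
    exact_mod_cast hh
  · have h0 : 0 ≤ meromorphicOrderAt K z := by
      rw [hKadd]
      refine le_trans ?_ (meromorphicOrderAt_add (hG z) (MeromorphicAt.const _ _))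
      rw [hg, hconst, hzero]
      simp
    rcases eq_or_ne (meromorphicOrderAt K z) 0 with h1 | h1
    · left
      have := meromorphicOrderAt_logDeriv_nonneg hmero h1
      rw [← hh] at this
      exact_mod_cast this
    · right
      rw [meromorphicOrderAt_logDeriv_eq_neg_one hmero h1 hG1] at hh
      refine ⟨WithTop.coe_injective hh, ?_⟩
      lift meromorphicOrderAt K z to ℤ using hG1 with e
      have h2 : 0 ≤ e := by exact_mod_cast h0
      have h3 : e ≠ 0 := by exact_mod_cast h1
      exact ⟨e, by omega, rfl⟩

/-- Finitely many points carry a divisor whose counting function is `O(log r)`; this is how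
finiteness of the zeros of `M[f] - φ` enters. -/
lemma exists_locallyFinsupp_of_finite {s : Set ℂ} (hs : s.Finite) :
    ∃ Z : Function.locallyFinsupp ℂ ℤ, 0 ≤ Z ∧ (∀ z ∈ s, 1 ≤ Z z) ∧
      Asymptotics.IsBigO atTop Z.logCounting Real.log := by
  classical
  induction s, hs using Set.Finite.induction_on with
  | empty => exact ⟨0, le_rfl, by simp, by rw [map_zero]; exact Asymptotics.isBigO_zero _ _⟩
  | @insert x s _ _ ih =>
    obtain ⟨Z, h0, h1, h2⟩ := ih
    have h3 : 0 ≤ Function.locallyFinsuppWithin.single x (1 : ℤ) :=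
      Function.locallyFinsuppWithin.single_nonneg.2 zero_le_one
    refine ⟨Z + Function.locallyFinsuppWithin.single x 1, add_nonneg h0 h3, ?_, ?_⟩
    · intro z hz
      rw [Function.locallyFinsuppWithin.coe_add, Pi.add_apply]
      rcases mem_insert_iff.1 hz with rfl | hz
      · have := h0 z
        simp only [Function.locallyFinsuppWithin.coe_zero, Pi.zero_apply] at this
        simp
        omega
      · have := h1 z hz
        have h4 := h3 z
        simp only [Function.locallyFinsuppWithin.coe_zero, Pi.zero_apply] at h4
        omega
    · rw [map_add]
      exact h2.add Function.locallyFinsuppWithin.logCounting_single_isBigO_log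

/-! ### The differential monomial -/

/-- The product of powers of derivatives in a differential monomial. -/
noncomputable def derivProd (k : ℕ) (q : ℕ → ℕ) (f : ℂ → ℂ) : ℂ → ℂ :=
  ∏ i ∈ Finset.range (k + 1), iteratedDeriv i f ^ q i

section Monomial

variable {f a φ : ℂ → ℂ} {k : ℕ} {q : ℕ → ℕ}

lemma differentialMonomial_eq : differentialMonomial a k q f = a * derivProd k q f := by
  ext z
  simp [differentialMonomial, derivProd]

lemma meromorphic_derivProd (hf : Meromorphic f) : Meromorphic (derivProd k q f) :=
  Meromorphic.prod fun i _ => (hf.iteratedDeriv i).pow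

/-- Where `f` has no pole, all derivatives have nonnegative order, so the factor `f ^ q 0` alone
supplies `3p`. -/
lemma exists_meromorphicOrderAt_derivProd (hf : Meromorphic f)
    (hf' : ∀ n z, meromorphicOrderAt (iteratedDeriv n f) z ≠ ⊤) (hq : 3 ≤ q 0) {z : ℂ} {p : ℤ}
    (hp : meromorphicOrderAt f z = p) :
    ∃ s : ℤ, meromorphicOrderAt (derivProd k q f) z = s ∧ (0 ≤ p → 3 * p ≤ s) := by
  choose o ho using fun n => WithTop.ne_top_iff_exists.1 (hf' n z)
  refine ⟨∑ i ∈ Finset.range (k + 1), q i * o i, ?_, fun hp0 => ?_⟩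
  · rw [derivProd, meromorphicOrderAt_prod fun i _ => (hf.iteratedDeriv i z).pow (q i)]
    push_cast
    refine Finset.sum_congr rfl fun i _ => ?_
    rw [meromorphicOrderAt_pow (hf.iteratedDeriv i z), ← ho i]
  · have h0 : o 0 = p := by
      have := ho 0
      rw [iteratedDeriv_zero, hp] at this
      exact_mod_cast this
    have h1 : ∀ i, 0 ≤ o i := fun i => by
      have := meromorphicOrderAt_iteratedDeriv_nonneg hf (z := z)
        (by rw [hp]; exact_mod_cast hp0) i
      rw [← ho i] at this
      exact_mod_cast this
    calc 3 * p ≤ q 0 * o 0 := by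
          rw [h0]
          exact mul_le_mul_of_nonneg_right (by exact_mod_cast hq) hp0
      _ ≤ _ := Finset.single_le_sum (f := fun i => (q i : ℤ) * o i)
          (fun i _ => mul_nonneg (Int.natCast_nonneg _) (h1 i)) (by simp)

lemma exists_meromorphicOrderAt_monomial_div (hf : Meromorphic f)
    (hf' : ∀ n z, meromorphicOrderAt (iteratedDeriv n f) z ≠ ⊤) (hq : 3 ≤ q 0)
    (ha : Meromorphic a) (hφ : Meromorphic φ) {z : ℂ} {α β p : ℤ}
    (hα : meromorphicOrderAt a z = α) (hβ : meromorphicOrderAt φ z = β)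
    (hp : meromorphicOrderAt f z = p) :
    ∃ g : ℤ, meromorphicOrderAt (a * φ⁻¹ * derivProd k q f) z = g ∧
      (0 ≤ p → α - β + 3 * p ≤ g) := by
  obtain ⟨s, hs, hs'⟩ := exists_meromorphicOrderAt_derivProd (k := k) hf hf' hq hp
  refine ⟨α - β + s, ?_, fun h => by have := hs' h; omega⟩
  rw [meromorphicOrderAt_mul ((ha.mul hφ.inv) z) (meromorphic_derivProd hf z),
    meromorphicOrderAt_mul (ha z) (hφ.inv z), meromorphicOrderAt_inv, hα, hβ, hs, sub_eq_add_neg]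
  rfl

/-- `M[f] - φ = (G - 1) φ`, so orders add. -/
lemma isMeromorphicZero_sub_of_le (hf : Meromorphic f) (ha : Meromorphic a)
    (hφ : Meromorphic φ) (hφ' : ∀ z, meromorphicOrderAt φ z ≠ ⊤) {z : ℂ} {e β : ℤ}
    (he : meromorphicOrderAt (fun w => (a * φ⁻¹ * derivProd k q f) w - 1) z = e)
    (hβ : meromorphicOrderAt φ z = β) (h : 1 ≤ e + β) :
    IsMeromorphicZero (fun w => differentialMonomial a k q f w - φ w) z := by
  have hG : Meromorphic (a * φ⁻¹ * derivProd k q f) :=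
    (ha.mul hφ.inv).mul (meromorphic_derivProd hf)
  refine ⟨(e + β).toNat, by omega, ?_⟩
  rw [Int.toNat_of_nonneg (by omega)]
  have h1 : (fun w => differentialMonomial a k q f w - φ w) =ᶠ[codiscrete ℂ]
      (fun w => (a * φ⁻¹ * derivProd k q f) w - 1) * φ := by
    filter_upwards [eventually_codiscrete_ne_zero hφ hφ'] with w hw
    simp only [differentialMonomial_eq, Pi.mul_apply, Pi.inv_apply]
    field_simp
  rw [meromorphicOrderAt_congr (eventuallyEq_nhdsNE_of_codiscrete h1 z),
    meromorphicOrderAt_mul ((hG.fun_sub (Meromorphic.const 1)) z) (hφ z), he, hβ]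
  rfl

/-- Comparison of divisors: zeros of `f` are multiple poles of `(G - 1) / G'`, where
`G = M[f] / φ`. -/
lemma neg_divisor_logDeriv_le (hf : Meromorphic f)
    (hf' : ∀ n z, meromorphicOrderAt (iteratedDeriv n f) z ≠ ⊤) (hq : 3 ≤ q 0)
    (ha : Meromorphic a) (ha' : ∀ z, meromorphicOrderAt a z ≠ ⊤)
    (hφ : Meromorphic φ) (hφ' : ∀ z, meromorphicOrderAt φ z ≠ ⊤)
    (hG1 : ∀ z, meromorphicOrderAt (fun w => (a * φ⁻¹ * derivProd k q f) w - 1) z ≠ ⊤)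
    (hdG : ∀ z, meromorphicOrderAt (deriv (a * φ⁻¹ * derivProd k q f)) z ≠ ⊤)
    {Z : Function.locallyFinsupp ℂ ℤ} (hZ : 0 ≤ Z)
    (hZ' : ∀ z, IsMeromorphicZero (fun w => differentialMonomial a k q f w - φ w) z → 1 ≤ Z z) :
    -divisor (logDeriv fun w => (a * φ⁻¹ * derivProd k q f) w - 1) univ + 2 • (divisor f univ)⁺ ≤
      (divisor f univ)⁻ + Z + 2 • (((divisor a univ)⁺ + (divisor a univ)⁻) +
        ((divisor φ univ)⁺ + (divisor φ univ)⁻)) := by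
  intro z
  have hG : Meromorphic (a * φ⁻¹ * derivProd k q f) :=
    (ha.mul hφ.inv).mul (meromorphic_derivProd hf)
  obtain ⟨α, hα⟩ := WithTop.ne_top_iff_exists.1 (ha' z)
  obtain ⟨β, hβ⟩ := WithTop.ne_top_iff_exists.1 (hφ' z)
  obtain ⟨p, hp⟩ := WithTop.ne_top_iff_exists.1 (hf' 0 z)
  rw [iteratedDeriv_zero] at hp
  obtain ⟨g, hg, hpg⟩ := exists_meromorphicOrderAt_monomial_div (k := k) hf hf' hq ha hφ
    hα.symm hβ.symm hp.symm
  obtain ⟨h, hh, h1, h2, h3⟩ := meromorphicOrderAt_logDeriv_sub_one hG hg (hG1 z) (hdG z)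
  have hZ0 : 0 ≤ Z z := hZ z
  -- A zero of `G - 1` is a zero of `M[f] - φ` unless a pole of `φ` cancels it, and that pole is
  -- charged to `φ`.
  have h4 : h = -1 → g = 0 → 0 ≤ h ∨ 1 ≤ Z z ∨ β ≤ -1 := by
    intro _ hg0
    rcases h3 hg0 with h3 | ⟨-, e, he, he'⟩
    · exact Or.inl h3
    · by_cases hb : 1 ≤ e + β
      · exact Or.inr (Or.inl (hZ' z (isMeromorphicZero_sub_of_le hf ha hφ hφ' he' hβ.symm hb)))
      · right; right; omega
  have h5 : g = 0 → 0 ≤ h ∨ h = -1 := fun hg0 => (h3 hg0).imp id fun h => h.1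
  simp only [Function.locallyFinsuppWithin.coe_add, Function.locallyFinsuppWithin.coe_neg,
    Function.locallyFinsuppWithin.coe_nsmul, Pi.add_apply, Pi.neg_apply, Pi.smul_apply,
    Function.locallyFinsuppWithin.posPart_apply, Function.locallyFinsuppWithin.negPart_apply,
    divisor_apply hf.meromorphicOn (mem_univ z), divisor_apply ha.meromorphicOn (mem_univ z),
    divisor_apply hφ.meromorphicOn (mem_univ z),
    divisor_apply (hG.fun_sub (Meromorphic.const 1)).logDeriv.meromorphicOn (mem_univ z),
    hh, ← hα, ← hβ, ← hp, WithTop.untop₀_coe]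
  simp only [posPart_def, negPart_def, nsmul_eq_mul]
  push_cast
  -- What remains is integer arithmetic. For `p ≥ 1` and `g > 0` it reads `1 - g + 2p ≤ 1 - p - α +
  -- β ≤ |α| + |β|`. If `g ≤ 0 ≤ p`, then `3p ≤ β - α`. If `p < 0`, a possible simple pole of the
  -- logarithmic derivative coming from `g < 0` is paid for by the pole of `f`.
  clear hh hg h3 hZ' hG1 hdG hG hα hβ hp
  omega

end Monomial

/-! ### Nevanlinna estimates for the monomial -/

section Monomial

open Asymptotics

variable {f a φ : ℂ → ℂ} {k : ℕ} {q : ℕ → ℕ}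

/-- A constant `G` has order zero everywhere, so a zero of `f` of order `p` must satisfy `3p ≤ β -
α`, with `α`, `β` the orders of `a`, `φ`: zeros of `f` are charged to the small functions. -/
lemma two_nsmul_posPart_divisor_le_of_eq_const (hf : Meromorphic f)
    (hf' : ∀ n z, meromorphicOrderAt (iteratedDeriv n f) z ≠ ⊤) (hq : 3 ≤ q 0)
    (ha : Meromorphic a) (ha' : ∀ z, meromorphicOrderAt a z ≠ ⊤)
    (hφ : Meromorphic φ) (hφ' : ∀ z, meromorphicOrderAt φ z ≠ ⊤) {c : ℂ}
    (hc : a * φ⁻¹ * derivProd k q f =ᶠ[codiscrete ℂ] fun _ => c) :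
    2 • (divisor f univ)⁺ ≤ ((divisor a univ)⁺ + (divisor a univ)⁻) +
        ((divisor φ univ)⁺ + (divisor φ univ)⁻) := by
  intro z
  obtain ⟨α, hα⟩ := WithTop.ne_top_iff_exists.1 (ha' z)
  obtain ⟨β, hβ⟩ := WithTop.ne_top_iff_exists.1 (hφ' z)
  obtain ⟨p, hp⟩ := WithTop.ne_top_iff_exists.1 (hf' 0 z)
  rw [iteratedDeriv_zero] at hp
  obtain ⟨g, hg, hpg⟩ := exists_meromorphicOrderAt_monomial_div (k := k) hf hf' hq ha hφ
    hα.symm hβ.symm hp.symm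
  have hg0 : g = 0 := by
    classical
    rw [meromorphicOrderAt_congr (eventuallyEq_nhdsNE_of_codiscrete hc z),
      meromorphicOrderAt_const] at hg
    split_ifs at hg
    · exact absurd hg WithTop.top_ne_coe
    · exact_mod_cast hg.symm
  simp only [Function.locallyFinsuppWithin.coe_add,
    Function.locallyFinsuppWithin.coe_nsmul, Pi.add_apply, Pi.smul_apply,
    Function.locallyFinsuppWithin.posPart_apply, Function.locallyFinsuppWithin.negPart_apply,
    divisor_apply hf.meromorphicOn (mem_univ z), divisor_apply ha.meromorphicOn (mem_univ z),
    divisor_apply hφ.meromorphicOn (mem_univ z), ← hα, ← hβ, ← hp, WithTop.untop₀_coe]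
  simp only [posPart_def, negPart_def, nsmul_eq_mul]
  push_cast
  clear hg hα hβ hp
  omega

/-- Needed so that error terms small relative to `G` and `G - 1` are also small relative to `f`. -/
lemma characteristic_monomial_div_isBigO (hf : IsTranscendentalMeromorphic f)
    (ha : IsSmallFunction a f) (hφ : IsSmallFunction φ f) :
    characteristic (a * φ⁻¹ * derivProd k q f) ⊤ =O[atTopOffFinite] characteristic f ⊤ := by
  have hlog := hf.log_isLittleO
  have hi : ∀ z, meromorphicOrderAt φ⁻¹ z ≠ ⊤ := fun z => by
    rw [meromorphicOrderAt_inv]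
    obtain ⟨β, hβ⟩ := WithTop.ne_top_iff_exists.1 (hφ.meromorphicOrderAt_ne_top z)
    rw [← hβ]
    exact WithTop.coe_ne_top (a := -β)
  have hm : ∀ z, meromorphicOrderAt (a * φ⁻¹) z ≠ ⊤ := fun z => by
    rw [meromorphicOrderAt_mul (ha.1 z) (hφ.1.inv z)]
    exact WithTop.add_ne_top.2 ⟨ha.meromorphicOrderAt_ne_top z, hi z⟩
  refine characteristic_mul_isBigO (ha.1.mul hφ.1.inv) hm (meromorphic_derivProd hf.1)
    (meromorphicOrderAt_prod_pow_ne_top _ hf.1.iteratedDeriv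
      hf.meromorphicOrderAt_iteratedDeriv_ne_top q)
    (characteristic_mul_isBigO ha.1 ha.meromorphicOrderAt_ne_top hφ.1.inv hi
      ha.characteristic_isLittleO.isBigO
      (characteristic_inv_isLittleO hlog hφ.1 hφ.characteristic_isLittleO).isBigO)
    (characteristic_prod_isBigO hlog _ hf.1.iteratedDeriv
      hf.meromorphicOrderAt_iteratedDeriv_ne_top
      (characteristic_iteratedDeriv_isBigO hlog hf.1
        hf.meromorphicOrderAt_iteratedDeriv_ne_top (isBigO_refl _ _)) q)

/-- `1 / f ^ d` is bounded by `1 / G` up to small proximity, where `G = M[f] / φ` has degree `d`. -/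
lemma exists_sum_mul_proximity_inv_le (hf : IsTranscendentalMeromorphic f)
    (ha : IsSmallFunction a f) (hφ : IsSmallFunction φ f) :
    ∃ E : ℝ → ℝ, E =o[atTopOffFinite] characteristic f ⊤ ∧ ∀ᶠ r in atTopOffFinite,
      (∑ i ∈ Finset.range (k + 1), q i : ℕ) * proximity f⁻¹ ⊤ r ≤
        proximity (a * φ⁻¹ * derivProd k q f)⁻¹ ⊤ r + E r := by
  have hlog := hf.log_isLittleO
  have hf0 := hf.meromorphicOrderAt_iteratedDeriv_ne_top
  set Q : ℂ → ℂ := ∏ i ∈ Finset.range (k + 1), (iteratedDeriv i f / f) ^ q i with hQ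
  have hdiv : ∀ i, Meromorphic (iteratedDeriv i f / f) := fun i => (hf.1.iteratedDeriv i).div hf.1
  have hQm : Meromorphic Q := Meromorphic.prod fun i _ => (hdiv i).pow
  have hQo : proximity Q ⊤ =o[atTopOffFinite] characteristic f ⊤ :=
    proximity_prod_isLittleO hlog _ hdiv
      (proximity_iteratedDeriv_div_isLittleO hlog hf.1 hf0 (isBigO_refl _ _)) q
  have hGm : Meromorphic (a * φ⁻¹ * derivProd k q f) :=
    (ha.1.mul hφ.1.inv).mul (meromorphic_derivProd hf.1)
  have hcm : Meromorphic (a * φ⁻¹ * Q) := (ha.1.mul hφ.1.inv).mul hQm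
  have hco : proximity (a * φ⁻¹ * Q) ⊤ =o[atTopOffFinite] characteristic f ⊤ :=
    proximity_mul_isLittleO (ha.1.mul hφ.1.inv) hQm
      (proximity_mul_isLittleO ha.1 hφ.1.inv (proximity_isLittleO ha.characteristic_isLittleO)
        (proximity_isLittleO
          (characteristic_inv_isLittleO hlog hφ.1 hφ.characteristic_isLittleO))) hQo
  refine ⟨_, hco, ?_⟩
  filter_upwards [eventually_atTopOffFinite_ge 1] with r hr
  -- Dividing each of the `d` factors of `M[f]` by `f` gives `G = (a / φ) Q f ^ d`, where `Q` is a
  -- product of powers of `f^{(i)} / f` and has small proximity.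
  have heq : f⁻¹ ^ (∑ i ∈ Finset.range (k + 1), q i) =ᶠ[codiscrete ℂ]
      (a * φ⁻¹ * derivProd k q f)⁻¹ * (a * φ⁻¹ * Q) := by
    have hall : ∀ᶠ z in codiscrete ℂ, ∀ i ∈ Finset.range (k + 1), iteratedDeriv i f z ≠ 0 :=
      (eventually_all_finset _).2 fun i _ =>
        eventually_codiscrete_ne_zero (hf.1.iteratedDeriv i) (hf0 i)
    filter_upwards [eventually_codiscrete_ne_zero hf.1 hf.meromorphicOrderAt_ne_top,
      eventually_codiscrete_ne_zero ha.1 ha.meromorphicOrderAt_ne_top,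
      eventually_codiscrete_ne_zero hφ.1 hφ.meromorphicOrderAt_ne_top, hall] with z h1 h2 h3 h4
    have h5 : derivProd k q f z ≠ 0 := by
      rw [derivProd, Finset.prod_apply]
      exact Finset.prod_ne_zero_iff.2 fun i hi => pow_ne_zero _ (h4 i hi)
    have h6 : Q z = derivProd k q f z / f z ^ ∑ i ∈ Finset.range (k + 1), q i := by
      rw [hQ, derivProd, Finset.prod_apply, Finset.prod_apply, ← Finset.prod_pow_eq_pow_sum,
        ← Finset.prod_div_distrib]
      simp [div_pow]
    simp only [Pi.mul_apply, Pi.inv_apply, Pi.pow_apply, h6, inv_pow]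
    field_simp
  have h1 := proximity_congr_codiscrete (a := ⊤) heq (r := r) (by linarith)
  rw [proximity_pow_top] at h1
  have h2 := proximity_mul_top_le hGm.inv hcm r
  simp only [Pi.smul_apply, nsmul_eq_mul, Pi.add_apply] at h1 h2
  linarith

/-- The proximity function of `1 / G`, in terms of the divisor of `G' / (G - 1)`. -/
lemma exists_proximity_inv_le {T : ℝ → ℝ} {G : ℂ → ℂ} (hlog : Real.log =o[atTopOffFinite] T)
    (hG : Meromorphic G) (hG0 : ∀ z, meromorphicOrderAt G z ≠ ⊤)
    (hG1 : ∀ z, meromorphicOrderAt (fun w => G w - 1) z ≠ ⊤)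
    (hdG : ∀ z, meromorphicOrderAt (deriv G) z ≠ ⊤)
    (hT : characteristic G ⊤ =O[atTopOffFinite] T) :
    ∃ E : ℝ → ℝ, E =o[atTopOffFinite] T ∧ ∀ᶠ r in atTopOffFinite,
      proximity G⁻¹ ⊤ r ≤ (-divisor (logDeriv fun w => G w - 1) univ).logCounting r + E r := by
  set K : ℂ → ℂ := fun w => G w - 1 with hK
  have hKm : Meromorphic K := hG.fun_sub (Meromorphic.const 1)
  have hKT : characteristic K ⊤ =O[atTopOffFinite] T := by
    have h1 : (characteristic G ⊤ - characteristic K ⊤) =O[atTopOffFinite] T :=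
      ((isBigO_characteristic_sub_characteristic_shift (a₀ := 1) hG).mono
        atTopOffFinite_le_atTop).trans (const_isLittleO hlog 1).isBigO
    exact (hT.sub h1).congr_left fun r => by simp
  have hLG := proximity_logDeriv_isLittleO hlog hG hG0 hT
  have hLK := proximity_logDeriv_isLittleO hlog hKm hG1 hKT
  set H := logDeriv K with hH
  have hHm : Meromorphic H := hKm.logDeriv
  set c := Real.log ‖meromorphicTrailingCoeffAt H 0‖ with hc
  -- `log 2` is the cost of the sum `1 + (⋯)`, and `-c` is the Jensen constant in passing from `T(r,
  -- 1/H)` to `T(r, H)`.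
  refine ⟨_, ((hLG.add hLK).add (const_isLittleO hlog (Real.log 2 - c))), ?_⟩
  filter_upwards [eventually_atTopOffFinite_ge 1] with r hr
  have hr0 : r ≠ 0 := by linarith
  have hdK : deriv K = deriv G := funext fun w => deriv_sub_const (f := G) (x := w) 1
  have heq : G⁻¹ =ᶠ[codiscrete ℂ] (fun _ => 1) + (fun _ => -1) * (logDeriv G * H⁻¹) := by
    filter_upwards [eventually_codiscrete_ne_zero hG hG0, eventually_codiscrete_ne_zero hKm hG1,
      eventually_codiscrete_ne_zero hG.deriv hdG] with z h1 h2 h3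
    simp only [Pi.add_apply, Pi.mul_apply, Pi.inv_apply, logDeriv_apply, hH, hdK]
    have h4 : K z = G z - 1 := rfl
    field_simp
    rw [h4]
    ring
  have h1 := proximity_congr_codiscrete (a := ⊤) heq hr0
  have h2 := proximity_add_top_le (Meromorphic.const (1 : ℂ))
    ((Meromorphic.const (-1 : ℂ)).mul (hG.logDeriv.mul hHm.inv)) r
  have h3 := proximity_mul_top_le (Meromorphic.const (-1 : ℂ)) (hG.logDeriv.mul hHm.inv) r
  have h4 := proximity_mul_top_le hG.logDeriv hHm.inv r
  have h5 := characteristic_sub_characteristic_inv_of_ne_zero hHm hr0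
  have h6 := congrFun (log_counting_zero_sub_logCounting_top (f := H)) r
  simp only [Pi.add_apply, Pi.sub_apply, proximity_const, norm_neg, norm_one, Real.posLog_one,
    characteristic, logCounting_inv] at h2 h3 h4 h5 h6
  rw [map_neg, Pi.neg_apply, h6]
  linarith

/-- If `M[f] - φ` has only finitely many zeros, the zeros of `f` are controlled by its poles. -/
lemma exists_proximity_inv_add_logCounting_le (hf : IsTranscendentalMeromorphic f)
    (ha : IsSmallFunction a f) (hφ : IsSmallFunction φ f) (hq : 3 ≤ q 0)
    (hfin : {z : ℂ | IsMeromorphicZero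
      (fun w => differentialMonomial a k q f w - φ w) z}.Finite) :
    ∃ E : ℝ → ℝ, E =o[atTopOffFinite] characteristic f ⊤ ∧ ∀ᶠ r in atTopOffFinite,
      proximity (a * φ⁻¹ * derivProd k q f)⁻¹ ⊤ r + 2 * logCounting f 0 r ≤
        logCounting f ⊤ r + E r := by
  have hlog := hf.log_isLittleO
  have hf0 := hf.meromorphicOrderAt_iteratedDeriv_ne_top
  have hGm : Meromorphic (a * φ⁻¹ * derivProd k q f) :=
    (ha.1.mul hφ.1.inv).mul (meromorphic_derivProd hf.1)
  have hAo := (ha.logCounting_abs_divisor_isLittleO hf).add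
    (hφ.logCounting_abs_divisor_isLittleO hf)
  -- For constant `G` the function `H` is unusable, since `G'` vanishes identically. Excluding this
  -- case also excludes `G = 0` and `G = 1`.
  by_cases hconst : ∃ c, a * φ⁻¹ * derivProd k q f =ᶠ[codiscrete ℂ] fun _ => c
  · obtain ⟨c, hc⟩ := hconst
    refine ⟨_, hAo.add (const_isLittleO hlog (log⁺ ‖c⁻¹‖)), ?_⟩
    filter_upwards [eventually_atTopOffFinite_ge 1] with r hr
    have h1 : (a * φ⁻¹ * derivProd k q f)⁻¹ =ᶠ[codiscrete ℂ] fun _ => c⁻¹ :=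
      hc.mono fun z hz => by rw [Pi.inv_apply, hz]
    have h2 := Function.locallyFinsuppWithin.logCounting_le
      (two_nsmul_posPart_divisor_le_of_eq_const hf.1 hf0 hq ha.1 ha.meromorphicOrderAt_ne_top
        hφ.1 hφ.meromorphicOrderAt_ne_top hc) hr
    have h3 : 0 ≤ logCounting f ⊤ r := logCounting_nonneg hr
    rw [proximity_congr_codiscrete h1 (by linarith), proximity_const]
    rw [map_nsmul, map_add _ (_ + _) (_ + _), ← logCounting_zero] at h2
    simp only [Pi.smul_apply, Pi.add_apply, nsmul_eq_mul, Nat.cast_ofNat] at h2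
    linarith
  · have hdG : ∀ z, meromorphicOrderAt (deriv (a * φ⁻¹ * derivProd k q f)) z ≠ ⊤ := fun z hz =>
      hconst (exists_eq_const_of_meromorphicOrderAt_deriv_eq_top hGm hz)
    have hG1 : ∀ z, meromorphicOrderAt
        (fun w => (a * φ⁻¹ * derivProd k q f) w - 1) z ≠ ⊤ := fun z hz => by
      refine hconst ⟨1, ?_⟩
      filter_upwards [eq_zero_of_exists_meromorphicOrderAt_eq_top
        (hGm.fun_sub (Meromorphic.const 1)) hz] with w hw
      exact sub_eq_zero.1 hw
    have hG0 : ∀ z, meromorphicOrderAt (a * φ⁻¹ * derivProd k q f) z ≠ ⊤ := fun z hz =>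
      hconst ⟨0, eq_zero_of_exists_meromorphicOrderAt_eq_top hGm hz⟩
    obtain ⟨Z, hZ0, hZ1, hZ⟩ := exists_locallyFinsupp_of_finite hfin
    obtain ⟨E, hE, hle⟩ := exists_proximity_inv_le hlog hGm hG0 hG1 hdG
      (characteristic_monomial_div_isBigO hf ha hφ)
    refine ⟨_, (hE.add ((hZ.mono atTopOffFinite_le_atTop).trans_isLittleO hlog)).add
      (hAo.const_mul_left 2), ?_⟩
    filter_upwards [eventually_atTopOffFinite_ge 1, hle] with r hr h1
    have h2 := Function.locallyFinsuppWithin.logCounting_le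
      (neg_divisor_logDeriv_le hf.1 hf0 hq ha.1 ha.meromorphicOrderAt_ne_top
        hφ.1 hφ.meromorphicOrderAt_ne_top hG1 hdG hZ0 hZ1) hr
    rw [map_add, map_add _ (_ + _) (2 • _), map_add _ _ Z, map_nsmul, map_nsmul,
      map_add _ (_ + _) (_ + _), ← logCounting_zero, ← logCounting_top] at h2
    simp only [two_nsmul, Pi.add_apply] at h2
    linarith

end Monomial

/-! ### Conclusion -/

theorem corollary2p5 (f : ℂ → ℂ) (hf : IsTranscendentalMeromorphic f)
    (a : ℂ → ℂ) (ha : IsSmallFunction a f)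
    (φ : ℂ → ℂ) (hφ : IsSmallFunction φ f)
    (k : ℕ) (hk : 1 ≤ k) (q : ℕ → ℕ) (hq0 : 3 ≤ q 0) (hqk : 1 ≤ q k) :
    {z : ℂ | IsMeromorphicZero (fun w => differentialMonomial a k q f w - φ w) z}.Infinite := by
  intro hfin
  have hlog := hf.log_isLittleO
  obtain ⟨E₁, hE₁, h₁⟩ := exists_sum_mul_proximity_inv_le (k := k) (q := q) hf ha hφ
  obtain ⟨E₂, hE₂, h₂⟩ := exists_proximity_inv_add_logCounting_le hf ha hφ hq0 hfin
  have hE₃ := characteristic_inv_sub_isLittleO hlog hf.1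
  have hd : 2 ≤ ∑ i ∈ Finset.range (k + 1), q i :=
    le_trans (by omega) (Finset.single_le_sum (f := q) (fun i _ => Nat.zero_le _)
      (Finset.mem_range.2 (Nat.succ_pos k)))
  -- The factor 2 converts `2 T(r, 1/f)` into `2 T(r, f)`. With total error at most `T / 2`, the
  -- estimates give `2 T ≤ T + T / 2`, while `T ≥ log r ≥ 1`.
  have hE := (hE₁.add hE₂).add (hE₃.const_mul_left 2)
  have hev : ∀ᶠ r in atTopOffFinite, False := by
    filter_upwards [h₁, h₂, hE.bound (half_pos one_pos), hlog.bound one_pos,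
      eventually_atTopOffFinite_ge (Real.exp 1)] with r h₁ h₂ hE hlogr hr
    have hr1 : 1 ≤ r := le_trans (Real.one_le_exp zero_le_one) hr
    have hlog1 : 1 ≤ Real.log r := (Real.le_log_iff_exp_le (by linarith)).2 hr
    have hT0 : 0 ≤ characteristic f ⊤ r := characteristic_nonneg hr1
    rw [Real.norm_of_nonneg hT0] at hE hlogr
    have h3 := (Real.le_norm_self _).trans hE
    have h4 := (Real.le_norm_self _).trans hlogr
    have hm0 : 0 ≤ proximity f⁻¹ ⊤ r := proximity_nonneg r
    have hm1 : 0 ≤ proximity f ⊤ r := proximity_nonneg r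
    have h5 : 2 * proximity f⁻¹ ⊤ r ≤
        (∑ i ∈ Finset.range (k + 1), q i : ℕ) * proximity f⁻¹ ⊤ r :=
      mul_le_mul_of_nonneg_right (by exact_mod_cast hd) hm0
    simp only [characteristic, Pi.add_apply, logCounting_inv] at *
    linarith
  exact atTopOffFinite_neBot.ne (eventually_false_iff_eq_bot.1 hev)
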